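/- **Setting.** On a probability space $(\Omega,P)$ let $\theta_n\in\mathbb R^d$, $w_n\in\mathbb R^k$, $Z^{(1)}_n\in\mathbb R^l$, $Z^{(2)}_n\in\mathbb R^m$, $M^{(1)}_n\in\mathbb R^d$, $M^{(2)}_n\in\mathbb R^k$ ($n\ge 0$) be random variables with $$\theta_{n+1}=\theta_n+a(n)\big[h(\theta_n,Z^{(1)}_n)+M^{(1)}_{n+1}\big],\qquad w_{n+1}=w_n+b(n)\big[g(\theta_n,w_n,Z^{(2)}_n)+M^{(2)}_{n+1}\big],$$ where $h,g$ are measurable, and let $\mathcal F_n=\sigma(\theta_j,w_j,M^{(i)}_j,Z^{(i)}_j:\ j\le n,\ i=1,2)$. Assume: (B1) There is a jointly measurable family of Markov kernels $\Pi^{(1)}_\theta$ on $\mathbb R^l$ with $P(Z^{(1)}_{n+1}\in A\mid\mathcal F_n)=\Pi^{(1)}_{\theta_n}(Z^{(1)}_n;A)$ a.s. for all Borel $A$ and all $n$; there are constants $\bar C,N$ with $\|Z^{(1)}_n\|<\bar C$ a.s. for all $n\ge N$; $\|h(\theta,z)\|\le K(1+\|\theta\|)$ for all $\theta,z$; for each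 $\theta$, $\Pi^{(1)}_\theta$ has a unique invariant probability $\Gamma^{(1)}_\theta$, and $\hat h(\theta)=\int h(\theta,z)\,\Gamma^{(1)}_\theta(dz)$ is Lipschitz; $\|M^{(1)}_{n+1}\|\le K'(1+\|\theta_n\|)$ a.s. for all $n$; for each $\theta$ the Poisson equation $(1-\Pi^{(1)}_\theta)v_\theta=h(\theta,\cdot)-\hat h(\theta)$ has a measurable, $\Pi^{(1)}_\theta(x;\cdot)$-integrable (for every $x$) solution $v_\theta$, and for every $R>0$ there is $C_R>0$ with $\|v_\theta(x)\|\le C_R(1+\|x\|)$ and $\|v_\theta(x)-v_{\theta'}(x)\|\le C_R\|\theta-\theta'\|(1+\|x\|)$ for all $x$ and all $\|\theta\|,\|\theta'\|\le R$. Moreover $\|g(\theta,w,z)\|\le K_1(1+\|\theta\|+\|w\|+\|z\|)$ for all $\theta,w,z$, and $\hat g(\theta,w)=\int g(\theta,w,z)\,\Gamma^{(2)}_{\theta,w}(dz)$ (with $\Gamma^{(2)}$ as in (B3), the integrand being integrable) is Lipschitz. (B2) $\{a(n)\}$ and $\{b(n)\}$ are non-increasing and positive, $\sum_n a(n)=\sum_n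 b(n)=\infty$, $\sum_n a(n)^2<\infty$, $\sum_n b(n)^2<\infty$, $a(n)<b(n)$ for all $n$, and $a(n)/b(n)\to0$. (B3) There is a jointly measurable family of Markov kernels $\Pi^{(2)}_{\theta,w}$ on $\mathbb R^m$ with $P(Z^{(2)}_{n+1}\in A\mid Z^{(2)}_j,\theta_j,w_j,\,j\le n)=\Pi^{(2)}_{\theta_n,w_n}(Z^{(2)}_n;A)$ a.s. for all Borel $A$ and all $n$; the conditions on the noise in (B1) (eventual a.s. boundedness by a constant, unique invariant probability $\Gamma^{(2)}_{\theta,w}$, a solution of the Poisson equation with the stated regularity) hold for $Z^{(2)},\Pi^{(2)},g$, with $\theta$ replaced by $(\theta,w)$. (B4) $M^{(1)}$ and $M^{(2)}$ are martingale difference sequences with respect to $(\mathcal F_n)$: $M^{(i)}_{n+1}$ is integrable and $E[M^{(i)}_{n+1}\mid\mathcal F_n]=0$ a.s. for all $n\ge0$. Also $\|M^{(2)}_{n+1}\|\le K_2(1+\|\theta_n\|+\|w_n\|)$ a.s. for all $n$. (B5) For each $\theta$ the point $\lambda(\theta)$ is a global attractor of $\dot w=\hat g(\theta,w)$ (an equilibrium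 to which every solution converges), and $\lambda:\mathbb R^d\to\mathbb R^k$ is Lipschitz. The o.d.e. $\dot\theta=\hat h(\theta)$ has a nonempty compact asymptotically stable set $H^s$ with domain of attraction $G^s$. For every compact $C\subset\mathbb R^d$ the set $\{(\theta,\lambda(\theta)):\theta\in C\}$ is Lyapunov stable for $\dot\theta=0,\ \dot w=\hat g(\theta,w)$. (B6) $\{(\theta_n,w_n)\}$ is asymptotically tight: for every $\epsilon>0$ there is a compact $K_\epsilon$ with $\limsup_n P((\theta_n,w_n)\in K_\epsilon)\ge1-\epsilon$. Let $B_1\subset\mathbb R^d$ be open with compact closure and $H^s\subset B_1\subset\overline{B_1}\subset G^s$, let $B_2\subset\mathbb R^k$ be open with compact closure, and put $S_1(n)=\sum_{i\ge n}a(i)^2$, $S_2(n)=\sum_{i\ge n}b(i)^2$. No stability (boundedness) of the iterates is assumed. **Theorem.** There are sequences $e_1,e_2\ge0$ with $e_1(n)=o(S_1(n))$ and $e_2(n)=o(S_2(n))$ as $n\to\infty$ such that, for all sufficiently large $n_0$, $1-e_1(n_0)-e_2(n_0)>0$ and, if $P(\theta_{n_0}\in B_1,\,w_{n_0}\in B_2)>0$,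 $$P\Big((\theta_n,w_n)\to\bigcup_{\theta\in H^s}\{(\theta,\lambda(\theta))\}\ \Big|\ \theta_{n_0}\in B_1,\ w_{n_0}\in B_2\Big)\ \ge\ \big(1-e_1(n_0)\big)\Big(1-\frac{e_2(n_0)}{1-e_1(n_0)-e_2(n_0)}\Big),$$ where convergence to a set means that the distance to it tends to $0$. -/

import Mathlib

open Filter Topology MeasureTheory ProbabilityTheory Asymptotics

namespace Tracking

noncomputable section

/-! ### Autonomous differential equations -/

section ODE

variable {X : Type*} [NormedAddCommGroup X] [NormedSpace ℝ X]

/-- `x` is a solution on `[0, ∞)` of `x' = F(x)` (one-sided derivative at `0`). -/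
def IsSolution (F : X → X) (x : ℝ → X) : Prop :=
  ∀ t : ℝ, 0 ≤ t → HasDerivWithinAt x (F (x t)) (Set.Ici 0) t

/-- Lyapunov stability of the set `A` for `x' = F(x)`. -/
def LyapunovStable (F : X → X) (A : Set X) : Prop :=
  ∀ ε : ℝ, 0 < ε → ∃ δ : ℝ, 0 < δ ∧ ∀ x : ℝ → X, IsSolution F x →
    Metric.infDist (x 0) A < δ → ∀ t : ℝ, 0 ≤ t → Metric.infDist (x t) A < ε

/-- The set of initial points from which the solution of `x' = F(x)` converges to `A`. -/
def domainOfAttraction (F : X → X) (A : Set X) : Set X :=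
  {x₀ | ∃ x : ℝ → X, IsSolution F x ∧ x 0 = x₀ ∧
    Tendsto (fun t => Metric.infDist (x t) A) atTop (𝓝 0)}

/-- `A` is a (nonempty, compact) asymptotically stable set of `x' = F(x)`. -/
def AsymptoticallyStable (F : X → X) (A : Set X) : Prop :=
  IsCompact A ∧ A.Nonempty ∧ LyapunovStable F A ∧
    ∃ U : Set X, IsOpen U ∧ A ⊆ U ∧ U ⊆ domainOfAttraction F A

/-- The point `p` is an equilibrium of `x' = F(x)` that attracts every solution. -/
def IsGlobalAttractor (F : X → X) (p : X) : Prop :=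
  F p = 0 ∧ ∀ x : ℝ → X, IsSolution F x → Tendsto x atTop (𝓝 p)

end ODE

/-! ### Step sizes -/

/-- Non-increasing positive step sizes with divergent sum and convergent sum of squares. -/
def IsStepSize (a : ℕ → ℝ) : Prop :=
  (∀ n, 0 < a n) ∧ Antitone a ∧ ¬ Summable a ∧ Summable (fun n => a n ^ 2)

/-- `∑_{i ≥ n} a(i)²`. -/
def tailSq (a : ℕ → ℝ) (n : ℕ) : ℝ := ∑' i : ℕ, a (n + i) ^ 2

/-! ### Parametrised Markov kernels, averaged vector fields, Poisson equation

`Π (x, s)` is the law of the next noise state when the parameter is `x` and the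
current noise state is `s`. -/

section Noise

variable {X S V : Type*} [NormedAddCommGroup X] [MeasurableSpace X]
  [NormedAddCommGroup S] [MeasurableSpace S]
  [NormedAddCommGroup V] [NormedSpace ℝ V] [MeasurableSpace V]

/-- For every parameter `x`, `Γ x` is the unique invariant probability of the kernel
`Π (x, ·)`. -/
def IsUniqueInvariant (Pi : Kernel (X × S) S) (Γ : X → Measure S) : Prop :=
  ∀ x, IsProbabilityMeasure (Γ x) ∧ (Pi.sectR x).Invariant (Γ x) ∧
    ∀ μ : Measure S, IsProbabilityMeasure μ → (Pi.sectR x).Invariant μ → μ = Γ x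

/-- The averaged field `x ↦ ∫ f(x, s) Γ_x(ds)`. -/
def meanField (Γ : X → Measure S) (f : X → S → V) (x : X) : V := ∫ s, f x s ∂(Γ x)

/-- For every `x` the Poisson equation `(1 - Π_x) v_x = f(x, ·) - ∫ f(x, s) Γ_x(ds)` has a
solution `v_x`, which has linear growth in the state and is Lipschitz in the parameter,
locally uniformly in the parameter. -/
def PoissonRegular (Pi : Kernel (X × S) S) (Γ : X → Measure S) (f : X → S → V) : Prop :=
  ∃ v : X → S → V,
    (∀ x, Measurable (v x)) ∧
    (∀ x s, Integrable (v x) (Pi (x, s))) ∧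
    (∀ x s, v x s - ∫ s', v x s' ∂(Pi (x, s)) = f x s - meanField Γ f x) ∧
    ∀ R : ℝ, 0 < R → ∃ C : ℝ, 0 < C ∧
      (∀ x s, ‖x‖ ≤ R → ‖v x s‖ ≤ C * (1 + ‖s‖)) ∧
      (∀ x x' s, ‖x‖ ≤ R → ‖x'‖ ≤ R → ‖v x s - v x' s‖ ≤ C * ‖x - x'‖ * (1 + ‖s‖))

end Noise

/-! ### Stochastic processes -/

section RandomSequences

variable {Ω : Type*}

/-- `σ(X_m, m ≤ n)`. -/
abbrev hist {S : Type*} [MeasurableSpace S] (X : ℕ → Ω → S) (n : ℕ) : MeasurableSpace Ω :=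
  ⨆ m : ℕ, ⨆ _ : m ≤ n, MeasurableSpace.comap (X m) inferInstance

variable [MeasurableSpace Ω]

/-- For `n` large, `‖Z_n‖` is almost surely bounded by one constant. -/
def EventuallyBounded {S : Type*} [NormedAddCommGroup S] (P : Measure Ω)
    (Z : ℕ → Ω → S) : Prop :=
  ∃ C : ℝ, 0 < C ∧ ∀ᶠ n in atTop, ∀ᵐ ω ∂P, ‖Z n ω‖ < C

/-- `P(Z_{n+1} ∈ A | ℱ_n) = Π (X_n, Z_n)(A)` almost surely, for all `n` and measurable `A`. -/
def IsMarkovNoise {X S : Type*} [MeasurableSpace X] [MeasurableSpace S] (P : Measure Ω)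
    (ℱ : ℕ → MeasurableSpace Ω) (Pi : Kernel (X × S) S)
    (x : ℕ → Ω → X) (Z : ℕ → Ω → S) : Prop :=
  ∀ (n : ℕ) (A : Set S), MeasurableSet A →
    P[(Z (n + 1) ⁻¹' A).indicator (fun _ => (1 : ℝ)) | ℱ n]
      =ᵐ[P] fun ω => (Pi (x n ω, Z n ω)).real A

/-- `(M_{n+1})_{n ≥ 0}` is integrable with `E[M_{n+1} | ℱ_n] = 0`; it is used with `ℱ_n`
containing `σ(M_m, m ≤ n)`, so that `M` is adapted. -/
def IsMartingaleDifference {V : Type*} [NormedAddCommGroup V] [NormedSpace ℝ V]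
    [CompleteSpace V] (P : Measure Ω) (ℱ : ℕ → MeasurableSpace Ω) (M : ℕ → Ω → V) : Prop :=
  ∀ n, Integrable (M (n + 1)) P ∧ P[M (n + 1) | ℱ n] =ᵐ[P] 0

/-- Asymptotic tightness: for every `ε > 0` some compact `K` has
`limsup_n P(X_n ∈ K) ≥ 1 - ε`. -/
def AsymptoticallyTight {S : Type*} [TopologicalSpace S] (P : Measure Ω)
    (X : ℕ → Ω → S) : Prop :=
  ∀ ε : ℝ, 0 < ε → ∃ K : Set S, IsCompact K ∧
    1 - ε ≤ limsup (fun n => P.real (X n ⁻¹' K)) atTop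

end RandomSequences

end

end Tracking

/-! Each recursion is a noisy Euler scheme for its averaged o.d.e., and the proof separates a
deterministic lock-in argument from a probability estimate for the noise.

Deterministic part. A Lyapunov stable set that attracts a compact set `U` pointwise attracts it
uniformly. A discrete Gronwall estimate shows that an Euler scheme with small defects follows the
flow over bounded time windows, so a scheme started in `U` keeps returning to `U`, stays in a ball
whose radius `R` depends on the o.d.e. only, and converges if the defects vanish asymptotically. The
defects need to be controlled only while the scheme is in that ball; this replaces stability of the
iterates (`exists_forall_norm_le_and_tendsto_infDist`).

Probabilistic part. The Poisson equation splits the noise into martingale differences and nearly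
telescoping terms, which Abel summation bounds by `O(b n + tailSq b n)`. Stopped outside the ball,
the differences are bounded by a constant times `b i`, so the fourth moment of their sum from `n₀`
on is `O(tailSq b n₀ ^ 2)`. Doob's inequality bounds the conditional probability of large noise by
the same order, which is `o(tailSq b n₀)`; second moments would only give `O(tailSq b n₀)`
(`exists_measure_inter_not_noiseSmall_le`).

Two timescales. For `θ` this gives lock-in to `Hs` directly. The pair `(θ, w)` is an Euler scheme
with steps `b` for `θ' = 0`, `w' = ĝ(θ, w)`; the motion of `θ` counts as a defect, small because `a
/ b → 0`. Hence the pair approaches the graph of `lam` over a ball, and since `θ` approaches `Hs`,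
the Lipschitz property of `lam` gives convergence to the graph over `Hs`. Outside two bad events
both conclusions hold, so the conditional probability is at least `1 - e₁ - e₂`, which dominates the
stated bound. -/

namespace Tracking

/-! ### Solutions of Lipschitz differential equations and uniform attraction -/

section ODE

open Set NNReal

variable {X : Type*} [NormedAddCommGroup X] [NormedSpace ℝ X] {F : X → X} {L : ℝ≥0}

theorem IsSolution.hasDerivWithinAt_Ici {x : ℝ → X} (hx : IsSolution F x) {t : ℝ} (ht : 0 ≤ t) :
    HasDerivWithinAt x (F (x t)) (Ici t) t :=
  (hx t ht).mono (Ici_subset_Ici.2 ht)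

theorem IsSolution.continuousOn {x : ℝ → X} (hx : IsSolution F x) (T : ℝ) :
    ContinuousOn x (Icc 0 T) := fun t ht =>
  ((hx t ht.1).continuousWithinAt).mono Icc_subset_Ici_self

theorem IsSolution.shift {x : ℝ → X} (hx : IsSolution F x) {s : ℝ} (hs : 0 ≤ s) :
    IsSolution F (fun t => x (s + t)) := by
  intro t ht
  have h1 := hx (s + t) (by positivity)
  have h2 : HasDerivWithinAt (fun t => s + t) (1 : ℝ) (Ici 0) t :=
    ((hasDerivAt_id t).const_add s).hasDerivWithinAt
  have := HasDerivWithinAt.scomp t h1 h2 (fun u hu => by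
    simp only [mem_Ici] at hu ⊢; positivity)
  simpa [Function.comp_def] using this

theorem IsSolution.dist_le (hF : LipschitzWith L F) {x y : ℝ → X} (hx : IsSolution F x)
    (hy : IsSolution F y) {t : ℝ} (ht : 0 ≤ t) :
    dist (x t) (y t) ≤ dist (x 0) (y 0) * Real.exp (L * t) := by
  have := dist_le_of_trajectories_ODE (v := fun _ => F) (fun _ => hF) (hx.continuousOn t)
    (fun s hs => hx.hasDerivWithinAt_Ici hs.1) (hy.continuousOn t)
    (fun s hs => hy.hasDerivWithinAt_Ici hs.1) le_rfl t ⟨ht, le_rfl⟩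
  simpa using this

theorem norm_le_of_lipschitzWith {Y : Type*} [NormedAddCommGroup Y] {F : Y → Y} {L : ℝ≥0}
    (hF : LipschitzWith L F) (x : Y) : ‖F x‖ ≤ L * ‖x‖ + ‖F 0‖ := by
  have h1 := hF.dist_le_mul x 0
  rw [dist_eq_norm, dist_zero_right] at h1
  have h2 := norm_sub_norm_le (F x) (F 0)
  linarith

theorem IsSolution.norm_le (hF : LipschitzWith L F) {x : ℝ → X} (hx : IsSolution F x) {R T t : ℝ}
    (hR : ‖x 0‖ ≤ R) (ht : 0 ≤ t) (htT : t ≤ T) :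
    ‖x t‖ ≤ gronwallBound R L ‖F 0‖ T := by
  have h1 := norm_le_gronwallBound_of_norm_deriv_right_le (hx.continuousOn t)
    (fun s hs => hx.hasDerivWithinAt_Ici hs.1) hR
    (fun s _ => norm_le_of_lipschitzWith hF (x s)) t ⟨ht, le_rfl⟩
  rw [sub_zero] at h1
  exact h1.trans (gronwallBound_mono ((norm_nonneg _).trans hR) (norm_nonneg _) L.2 htT)

/-- One explicit Euler step of size `s` from a point of a solution. -/
theorem IsSolution.norm_euler_step_le (hF : LipschitzWith L F) {x : ℝ → X} (hx : IsSolution F x)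
    {G t s : ℝ} (ht : 0 ≤ t) (hs : 0 ≤ s) (hG : ∀ u ∈ Icc t (t + s), ‖F (x u)‖ ≤ G) :
    ‖x (t + s) - x t - s • F (x t)‖ ≤ L * G * s ^ 2 := by
  have hsub : Icc t (t + s) ⊆ Ici 0 := fun u hu => ht.trans hu.1
  have hlip : ∀ u ∈ Icc t (t + s), ‖x u - x t‖ ≤ G * s := by
    intro u hu
    have := (convex_Icc t (t + s)).norm_image_sub_le_of_norm_hasDerivWithin_le
      (fun v hv => (hx v (hsub hv)).mono hsub) hG (left_mem_Icc.2 (by linarith)) hu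
    refine this.trans ?_
    have hG0 : 0 ≤ G := (norm_nonneg _).trans (hG u hu)
    gcongr
    rw [Real.norm_of_nonneg (by linarith [hu.1])]
    linarith [hu.2]
  have := (convex_Icc t (t + s)).norm_image_sub_le_of_norm_hasDerivWithin_le
    (f := fun u => x u - (u - t) • F (x t)) (f' := fun u => F (x u) - F (x t))
    (C := L * (G * s)) (x := t) (y := t + s) ?_ ?_
    (left_mem_Icc.2 (by linarith)) (right_mem_Icc.2 (by linarith))
  · simp only [add_sub_cancel_left, sub_self, zero_smul, sub_zero, Real.norm_of_nonneg hs] at this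
    calc _ = ‖x (t + s) - s • F (x t) - x t‖ := by congr 1; abel
      _ ≤ _ := this
      _ = _ := by ring
  · intro v hv
    have h1 := (hx v (hsub hv)).mono hsub
    have h2 : HasDerivWithinAt (fun u : ℝ => (u - t) • F (x t)) ((1 : ℝ) • F (x t))
      (Icc t (t + s)) v := (((hasDerivAt_id v).sub_const t).smul_const _).hasDerivWithinAt
    simpa using h1.fun_sub h2
  · intro v hv
    have h1 := hF.dist_le_mul (x v) (x t)
    rw [dist_eq_norm, dist_eq_norm] at h1
    exact h1.trans (by gcongr; exact hlip v hv)

/-- On the ball of radius `‖F p‖` about `p` the field has norm at most `(L + 1) * ‖F p‖`, so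
Picard–Lindelöf applies on an interval whose length does not depend on `p`. -/
theorem exists_hasDerivWithinAt_Icc [CompleteSpace X] (hF : LipschitzWith L F) (p : X) :
    ∃ α : ℝ → X, α 0 = p ∧ ∀ t ∈ Icc (0 : ℝ) (1 / (L + 1)),
      HasDerivWithinAt α (F (α t)) (Icc 0 (1 / (L + 1))) t := by
  have hτ : (0 : ℝ) ≤ 1 / (L + 1) := by positivity
  have h := IsPicardLindelof.of_time_independent (f := F) (tmin := 0) (tmax := 1 / (L + 1))
    (t₀ := ⟨0, left_mem_Icc.2 hτ⟩) (x₀ := p) (a := ‖F p‖₊) (r := 0) (L := (L + 1) * ‖F p‖₊)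
    (K := L) ?_ hF.lipschitzOnWith ?_
  · exact h.exists_eq_forall_mem_Icc_hasDerivWithinAt₀
  · intro x hx
    have h1 := hF.dist_le_mul x p
    rw [dist_eq_norm] at h1
    have h2 := norm_sub_norm_le (F x) (F p)
    rw [Metric.mem_closedBall] at hx
    have h3 : (L : ℝ) * dist x p ≤ L * ‖F p‖ := by gcongr; simpa using hx
    push_cast at hx ⊢
    linarith
  · simp only [sub_zero, sub_self, max_eq_left hτ]
    push_cast
    have : (L : ℝ) + 1 ≠ 0 := by positivity
    rw [sub_zero]
    field_simp
    exact le_rfl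

/-- The local existence time is the same at every point, so local solutions can be glued. Existence
matters because `IsGlobalAttractor` only speaks about solutions that are given. -/
theorem exists_isSolution [CompleteSpace X] (hF : LipschitzWith L F) (p : X) :
    ∃ x : ℝ → X, IsSolution F x ∧ x 0 = p := by
  choose α hα0 hα using exists_hasDerivWithinAt_Icc hF
  set τ : ℝ := 1 / (L + 1) with hτdef
  have hτ : 0 < τ := by positivity
  let q : ℕ → X := fun n => Nat.rec p (fun _ y => α y τ) n
  have hq : ∀ n, q (n + 1) = α (q n) τ := fun n => rfl
  let x : ℝ → X := fun t => α (q ⌊t / τ⌋₊) (t - ⌊t / τ⌋₊ * τ)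
  have hx : ∀ n : ℕ, ∀ t ∈ Icc (n * τ) ((n + 1) * τ), x t = α (q n) (t - n * τ) := by
    intro n t ht
    rcases ht.2.eq_or_lt with h | h
    · have h1 : t / τ = ((n + 1 : ℕ) : ℝ) := by rw [h]; push_cast; field_simp
      simp only [x]
      rw [h1, Nat.floor_natCast, hq, h]
      push_cast
      rw [sub_self, hα0]
      congr 1; ring
    · have h1 : ⌊t / τ⌋₊ = n := by
        rw [Nat.floor_eq_iff (div_nonneg ((by positivity : (0 : ℝ) ≤ n * τ).trans ht.1) hτ.le)]
        exact ⟨(le_div_iff₀ hτ).2 ht.1, (div_lt_iff₀ hτ).2 h⟩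
      simp only [x]
      rw [h1]
  have hd : ∀ n : ℕ, ∀ t ∈ Icc (n * τ) ((n + 1) * τ),
      HasDerivWithinAt x (F (x t)) (Icc (n * τ) ((n + 1) * τ)) t := by
    intro n t ht
    have h1 := hα (q n) (t - n * τ) ⟨by linarith [ht.1], by linarith [ht.2]⟩
    have h2 : HasDerivWithinAt (fun u : ℝ => u - n * τ) (1 : ℝ) (Icc (n * τ) ((n + 1) * τ)) t :=
      ((hasDerivAt_id t).sub_const _).hasDerivWithinAt
    have h3 := HasDerivWithinAt.scomp t h1 h2 (show MapsTo (fun u : ℝ => u - n * τ) _ (Icc 0 τ)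
      from fun u hu => ⟨by linarith [hu.1], by linarith [hu.2]⟩)
    rw [one_smul] at h3
    rw [hx n t ht]
    exact h3.congr (fun u hu => hx n u hu) (hx n t ht)
  refine ⟨x, fun t ht => ?_, ?_⟩
  · obtain ⟨n, hn⟩ : ∃ n : ℕ, ⌊t / τ⌋₊ = n := ⟨_, rfl⟩
    rw [Nat.floor_eq_iff (div_nonneg ht hτ.le), le_div_iff₀ hτ, div_lt_iff₀ hτ] at hn
    have h1 := hd n t ⟨hn.1, hn.2.le⟩
    have hleft : ∀ s : ℝ, s < t → Icc s ((n + 1) * τ) ∈ 𝓝 t := fun s hs => Icc_mem_nhds hs hn.2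
    rcases hn.1.lt_or_eq with h | h
    · exact (h1.hasDerivAt (hleft _ h)).hasDerivWithinAt
    · rcases Nat.eq_zero_or_pos n with h0 | h0
      · subst h0
        refine h1.mono_of_mem_nhdsWithin ?_
        have : Iic ((((0 : ℕ) : ℝ) + 1) * τ) ∈ 𝓝 t := Iic_mem_nhds hn.2
        filter_upwards [mem_nhdsWithin_of_mem_nhds this, self_mem_nhdsWithin] with u h1 h2
        exact ⟨by simpa using h2, h1⟩
      -- At a junction of two pieces the left and right derivatives are both `F (x t)`, so they
      -- combine on the union of the two intervals.
      · obtain ⟨k, rfl⟩ : ∃ k, n = k + 1 := ⟨n - 1, by omega⟩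
        push_cast at h h1 hn hleft
        have h2 := hd k t ⟨by nlinarith, h.ge⟩
        have h3 := h2.union h1
        rw [Icc_union_Icc_eq_Icc (by nlinarith) (by nlinarith)] at h3
        exact (h3.hasDerivAt (hleft _ (by nlinarith))).hasDerivWithinAt
  · have := hx 0 0 ⟨by simp, by simpa using hτ.le⟩
    rw [this]
    simp only [Nat.cast_zero, zero_mul, sub_zero]
    exact hα0 p

/-- A Lyapunov stable set which attracts every point of a compact set attracts it uniformly. -/
theorem exists_forall_infDist_lt (hF : LipschitzWith L F) {A U : Set X} (hU : IsCompact U)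
    (hUA : U ⊆ domainOfAttraction F A) (hA : LyapunovStable F A) {ε : ℝ} (hε : 0 < ε) :
    ∃ T : ℝ, 0 < T ∧ ∀ x : ℝ → X, IsSolution F x → x 0 ∈ U → ∀ t, T ≤ t →
      Metric.infDist (x t) A < ε := by
  obtain ⟨δ, hδ, hst⟩ := hA ε hε
  -- By continuous dependence, solutions starting close to `p` are still within `δ / 2` of the
  -- solution from `p` at a time `T` when that one is `δ / 2`-close to `A`; stability then traps
  -- them. The factor `exp (-(L * T))` compensates the Gronwall growth.
  have key : ∀ p ∈ U, ∃ s ∈ 𝓝[U] p, ∃ T : ℝ, 0 < T ∧ ∀ x : ℝ → X, IsSolution F x → x 0 ∈ s →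
      ∀ t, T ≤ t → Metric.infDist (x t) A < ε := by
    intro p hp
    obtain ⟨y, hy, hy0, hyA⟩ := hUA hp
    obtain ⟨T, hTδ, hT0⟩ : ∃ T, Metric.infDist (y T) A < δ / 2 ∧ 0 < T :=
      ((hyA.eventually_lt_const (half_pos hδ)).and (eventually_gt_atTop 0)).exists
    refine ⟨Metric.ball p (δ / 2 * Real.exp (-(L * T))), mem_nhdsWithin_of_mem_nhds
      (Metric.ball_mem_nhds _ (by positivity)), T, hT0, fun x hx hx0 t ht => ?_⟩
    have h1 := IsSolution.dist_le hF hx hy hT0.le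
    rw [Metric.mem_ball, ← hy0] at hx0
    have h2 : dist (x 0) (y 0) * Real.exp (L * T) < δ / 2 := by
      calc _ < δ / 2 * Real.exp (-(L * T)) * Real.exp (L * T) := by gcongr
        _ = δ / 2 := by rw [mul_assoc, ← Real.exp_add]; simp
    have h3 := Metric.infDist_le_infDist_add_dist (s := A) (x := x T) (y := y T)
    have h4 := hst _ (hx.shift hT0.le) (by simp only [add_zero]; linarith) (t - T) (by linarith)
    simpa using h4
  refine hU.induction_on (p := fun s => ∃ T : ℝ, 0 < T ∧ ∀ x : ℝ → X, IsSolution F x → x 0 ∈ s →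
      ∀ t, T ≤ t → Metric.infDist (x t) A < ε) ⟨1, one_pos, fun _ _ h => h.elim⟩ ?_ ?_ key
  · rintro s t hst ⟨T, h0, h⟩
    exact ⟨T, h0, fun x hx hxs => h x hx (hst hxs)⟩
  · rintro s t ⟨T, h0, h⟩ ⟨T', h0', h'⟩
    refine ⟨max T T', lt_max_of_lt_left h0, fun x hx hxs u hu => ?_⟩
    rcases hxs with hxs | hxs
    · exact h x hx hxs u ((le_max_left _ _).trans hu)
    · exact h' x hx hxs u ((le_max_right _ _).trans hu)

end ODE

/-! ### Euler schemes with defects follow the flow -/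

section DiscreteTracking

open Set NNReal

/-- The amount by which the sequence `x` fails, between the indices `n` and `m`, to be the Euler
scheme of `x' = F(x)` with step sizes `b`. -/
def eulerDefect {X : Type*} [NormedAddCommGroup X] [NormedSpace ℝ X] (F : X → X) (b : ℕ → ℝ)
    (x : ℕ → X) (n m : ℕ) : X :=
  x m - x n - ∑ i ∈ Finset.Ico n m, b i • F (x i)

variable {X : Type*} [NormedAddCommGroup X] [NormedSpace ℝ X] {F : X → X} {L : ℝ≥0}

/-- Subtracting the defect leaves a sequence `z` with increments exactly `b j • F (x j)`. Comparing
it with the flow costs `L * δ` per unit time for `F (x j)` in place of `F (z j)` and `L * G * b j ^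
2` per step for the Euler error; a discrete Gronwall induction sums these. -/
theorem norm_sub_le_of_eulerDefect (hF : LipschitzWith L F) {y : ℝ → X} (hy : IsSolution F y)
    {x : ℕ → X} {b : ℕ → ℝ} (hb : ∀ i, 0 ≤ b i) {n m : ℕ} (hnm : n ≤ m) {G β δ : ℝ}
    (hG : ∀ u ∈ Icc 0 (∑ i ∈ Finset.Ico n m, b i), ‖F (y u)‖ ≤ G) (hβ : ∀ i, n ≤ i → b i ≤ β)
    (hδ : ∀ j, n ≤ j → j ≤ m → ‖eulerDefect F b x n j‖ ≤ δ) (hy0 : y 0 = x n) :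
    ‖x m - y (∑ i ∈ Finset.Ico n m, b i)‖ ≤ δ + (L * δ + L * G * β) *
      (∑ i ∈ Finset.Ico n m, b i) * Real.exp (L * ∑ i ∈ Finset.Ico n m, b i) := by
  set s : ℕ → ℝ := fun j => ∑ i ∈ Finset.Ico n j, b i with hs
  set z : ℕ → X := fun j => x j - eulerDefect F b x n j with hz
  have hs0 : ∀ j, 0 ≤ s j := fun j => Finset.sum_nonneg fun i _ => hb i
  have hG0 : 0 ≤ G := (norm_nonneg _).trans (hG 0 ⟨le_rfl, hs0 m⟩)
  have hβ0 : 0 ≤ β := (hb n).trans (hβ n le_rfl)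
  have hδ0 : 0 ≤ δ := (norm_nonneg _).trans (hδ n le_rfl hnm)
  set κ : ℝ := L * δ + L * G * β with hκ
  have hκ0 : 0 ≤ κ := by positivity
  have key : ∀ j, n ≤ j → j ≤ m → ‖z j - y (s j)‖ ≤ κ * s j * Real.exp (L * s j) := by
    intro j hnj
    induction j, hnj using Nat.le_induction with
    | base => intro _; simp [z, s, eulerDefect, hy0]
    | succ j hnj ih =>
      intro hjm
      have ih := ih (by omega)
      have hsj : s (j + 1) = s j + b j := by simp [s, Finset.sum_Ico_succ_top hnj]
      have hzj : z (j + 1) = z j + b j • F (x j) := by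
        simp only [z, eulerDefect, Finset.sum_Ico_succ_top hnj]; abel
      have hle : s (j + 1) ≤ s m := Finset.sum_le_sum_of_subset_of_nonneg
        (Finset.Ico_subset_Ico_right hjm) fun i _ _ => hb i
      have h1 := hy.norm_euler_step_le hF (G := G) (hs0 j) (hb j)
        (fun u hu => hG u ⟨(hs0 j).trans hu.1, by rw [hsj] at hle; exact hu.2.trans hle⟩)
      have h2 : ‖F (x j) - F (y (s j))‖ ≤ L * (‖z j - y (s j)‖ + δ) := by
        have h3 := hF.dist_le_mul (x j) (y (s j))
        rw [dist_eq_norm, dist_eq_norm] at h3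
        refine h3.trans ?_
        gcongr
        calc ‖x j - y (s j)‖ = ‖(z j - y (s j)) + eulerDefect F b x n j‖ := by
              simp only [z]; congr 1; abel
          _ ≤ _ := (norm_add_le _ _).trans (by gcongr; exact hδ j hnj (by omega))
      have h4 : ‖z (j + 1) - y (s (j + 1))‖ ≤
          ‖z j - y (s j)‖ + b j * (L * (‖z j - y (s j)‖ + δ)) + L * G * b j ^ 2 := by
        calc ‖z (j + 1) - y (s (j + 1))‖
            = ‖(z j - y (s j)) + b j • (F (x j) - F (y (s j))) -
              (y (s j + b j) - y (s j) - b j • F (y (s j)))‖ := by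
              rw [hzj, hsj, smul_sub]; congr 1; abel
          _ ≤ ‖z j - y (s j)‖ + ‖b j • (F (x j) - F (y (s j)))‖ + L * G * b j ^ 2 :=
              (norm_sub_le _ _).trans (add_le_add (norm_add_le _ _) h1)
          _ ≤ _ := by
              rw [norm_smul, Real.norm_of_nonneg (hb j)]
              gcongr
              exact hb j
      have hbj : b j ^ 2 ≤ b j * β := by
        rw [sq]; exact mul_le_mul_of_nonneg_left (hβ j hnj) (hb j)
      have h5 : ‖z (j + 1) - y (s (j + 1))‖ ≤ (1 + L * b j) * ‖z j - y (s j)‖ + κ * b j := by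
        have : (L : ℝ) * G * b j ^ 2 ≤ L * G * (b j * β) := by gcongr
        refine h4.trans ?_
        rw [hκ]
        linarith
      refine h5.trans ?_
      rw [hsj]
      have hb0 := hb j
      have hE : (1 : ℝ) ≤ Real.exp (L * (s j + b j)) :=
        Real.one_le_exp (mul_nonneg L.2 (add_nonneg (hs0 j) hb0))
      have hE' : (1 + L * b j) * Real.exp (L * s j) ≤ Real.exp (L * (s j + b j)) := by
        rw [mul_add, Real.exp_add, mul_comm]
        gcongr
        linarith [Real.add_one_le_exp (L * b j)]
      calc (1 + L * b j) * ‖z j - y (s j)‖ + κ * b j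
          ≤ (1 + L * b j) * (κ * s j * Real.exp (L * s j)) + κ * b j * 1 := by
            rw [mul_one]; gcongr
        _ = κ * s j * ((1 + L * b j) * Real.exp (L * s j)) + κ * b j * 1 := by ring
        _ ≤ κ * s j * Real.exp (L * (s j + b j)) + κ * b j * Real.exp (L * (s j + b j)) := by
            have := hs0 j
            gcongr
        _ = _ := by ring
  calc ‖x m - y (s m)‖ = ‖eulerDefect F b x n m + (z m - y (s m))‖ := by
        simp only [z]; congr 1; abel
    _ ≤ δ + κ * s m * Real.exp (L * s m) :=
        (norm_add_le _ _).trans (add_le_add (hδ m hnm le_rfl) (key m hnm le_rfl))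

/-- Solutions from the ball of radius `ρ` stay in a Gronwall ball up to time `T`, so the previous
error is at most `δ * (1 + Q)` with `Q` independent of the scheme and its starting index. -/
theorem exists_norm_sub_le_of_eulerDefect (hF : LipschitzWith L F) (ρ : ℝ) {T η : ℝ}
    (hη : 0 < η) : ∃ δ : ℝ, 0 < δ ∧ ∀ (x : ℕ → X) (b : ℕ → ℝ) (n m : ℕ) (y : ℝ → X),
      IsSolution F y → y 0 = x n → (∀ i, 0 ≤ b i) → (∀ i, n ≤ i → b i ≤ δ) → ‖x n‖ ≤ ρ → n ≤ m →
      ∑ i ∈ Finset.Ico n m, b i ≤ T →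
      (∀ j, n ≤ j → j ≤ m → ‖eulerDefect F b x n j‖ ≤ δ) →
      ‖x m - y (∑ i ∈ Finset.Ico n m, b i)‖ ≤ η := by
  set G : ℝ := L * gronwallBound ρ L ‖F 0‖ T + ‖F 0‖ with hGdef
  set Q : ℝ := (L + L * |G|) * |T| * Real.exp (L * |T|) with hQ
  have hQ0 : 0 ≤ Q := by positivity
  refine ⟨η / (1 + Q), by positivity, fun x b n m y hy hy0 hb hbδ hρ hnm hT hdef => ?_⟩
  set δ := η / (1 + Q) with hδ
  have hδ0 : 0 < δ := by positivity
  have hs0 : 0 ≤ ∑ i ∈ Finset.Ico n m, b i := Finset.sum_nonneg fun i _ => hb i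
  have hTT : ∑ i ∈ Finset.Ico n m, b i ≤ |T| := hT.trans (le_abs_self T)
  refine (norm_sub_le_of_eulerDefect hF hy hb hnm (G := |G|) (fun u hu => ?_) hbδ hdef
    hy0).trans ?_
  · refine (norm_le_of_lipschitzWith hF _).trans (le_trans ?_ (le_abs_self G))
    rw [hGdef]
    gcongr
    exact hy.norm_le hF (hy0 ▸ hρ) hu.1 (hu.2.trans hT)
  · calc _ ≤ δ + (L * δ + L * |G| * δ) * |T| * Real.exp (L * |T|) := by gcongr
      _ = δ * (1 + Q) := by rw [hQ]; ring
      _ = η := by rw [hδ]; field_simp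

/-- Take the last index from which the elapsed time up to `m` is still at least `T`; since steps are
at most `1`, the overshoot is at most `1`. -/
theorem exists_sum_Ico_mem_Icc {b : ℕ → ℝ} {n₀ m : ℕ} (hb1 : ∀ i, n₀ ≤ i → b i ≤ 1)
    {T : ℝ} (hT : 0 ≤ T) (h : T ≤ ∑ i ∈ Finset.Ico n₀ m, b i) (hm : n₀ ≤ m) :
    ∃ n, n₀ ≤ n ∧ n ≤ m ∧ ∑ i ∈ Finset.Ico n m, b i ∈ Icc T (T + 1) := by
  classical
  set n := Nat.findGreatest (fun j => T ≤ ∑ i ∈ Finset.Ico j m, b i) m with hn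
  have h1 : n₀ ≤ n := Nat.le_findGreatest hm h
  have h2 : n ≤ m := Nat.findGreatest_le m
  have h3 : T ≤ ∑ i ∈ Finset.Ico n m, b i :=
    Nat.findGreatest_spec (P := fun j => T ≤ ∑ i ∈ Finset.Ico j m, b i) hm h
  refine ⟨n, h1, h2, h3, ?_⟩
  rcases h2.eq_or_lt with h4 | h4
  · rw [h4]; simp; linarith
  · have h5 := Nat.findGreatest_is_greatest (P := fun j => T ≤ ∑ i ∈ Finset.Ico j m, b i)
      (Nat.lt_succ_self n) h4
    rw [Finset.sum_eq_sum_Ico_succ_bot h4]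
    simp only [not_le] at h5
    linarith [hb1 n h1]

/-- Euler schemes with small defects that start in a compact part `U` of the domain of attraction
of a Lyapunov stable set stay bounded and come back to `U`. -/
theorem exists_norm_le_of_eulerDefect (hF : LipschitzWith L F) {A U D : Set X} (hU : IsCompact U)
    (hUA : U ⊆ domainOfAttraction F A) (hA : LyapunovStable F A) {r : ℝ} (hr : 0 < r)
    (hD : ∀ p ∈ D, Metric.infDist p A < r → p ∈ U) :
    ∃ R T δ : ℝ, 0 < T ∧ 0 < δ ∧ ∀ (x : ℕ → X) (b : ℕ → ℝ) (n₀ N : ℕ), (∀ i, 0 ≤ b i) →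
      (∀ i, n₀ ≤ i → b i ≤ δ) → x n₀ ∈ U → (∀ n, n₀ ≤ n → n ≤ N → x n ∈ D) →
      (∀ n m, n₀ ≤ n → n ≤ m → m ≤ N → ∑ i ∈ Finset.Ico n m, b i ≤ T →
        ‖eulerDefect F b x n m‖ ≤ δ) →
      ∀ n, n₀ ≤ n → n ≤ N → ‖x n‖ ≤ R ∧ (T ≤ ∑ i ∈ Finset.Ico n₀ n, b i → x n ∈ U) := by
  obtain ⟨ρ, hρ⟩ := hU.isBounded.exists_norm_le
  obtain ⟨T₀, hT₀, hatt⟩ := exists_forall_infDist_lt hF hU hUA hA (half_pos hr)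
  obtain ⟨δ, hδ, htrack⟩ := exists_norm_sub_le_of_eulerDefect hF ρ (T := 2 * T₀ + 1)
    (η := min 1 (r / 2)) (by positivity)
  refine ⟨gronwallBound ρ L ‖F 0‖ (2 * T₀ + 1) + 1, 2 * T₀ + 1, min δ 1, by positivity,
    by positivity, fun x b n₀ N hb hbδ hx₀ hxD hdef => ?_⟩
  have hsum0 : ∀ n m, 0 ≤ ∑ i ∈ Finset.Ico n m, b i :=
    fun n m => Finset.sum_nonneg fun i _ => hb i
  -- The induction uses the return time `T₀` instead of `2 * T₀ + 1`: an index that lies between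
  -- `T₀` and `T₀ + 1` time units before `m` is then already back in `U` once more than `2 * T₀ + 1`
  -- units have elapsed. At earlier times the comparison starts at `n₀` itself.
  suffices H : ∀ m, n₀ ≤ m → m ≤ N → ‖x m‖ ≤ gronwallBound ρ L ‖F 0‖ (2 * T₀ + 1) + 1 ∧
      (T₀ ≤ ∑ i ∈ Finset.Ico n₀ m, b i → x m ∈ U) from
    fun m h1 h2 => ⟨(H m h1 h2).1, fun h => (H m h1 h2).2 (by linarith)⟩
  intro m
  induction m using Nat.strong_induction_on with
  | _ m ih =>
    intro hm hmN
    obtain ⟨n, hn₀, hnm, hnU, hnT, hT₀n⟩ : ∃ n, n₀ ≤ n ∧ n ≤ m ∧ x n ∈ U ∧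
        ∑ i ∈ Finset.Ico n m, b i ≤ 2 * T₀ + 1 ∧
        (T₀ ≤ ∑ i ∈ Finset.Ico n₀ m, b i → T₀ ≤ ∑ i ∈ Finset.Ico n m, b i) := by
      rcases le_or_gt (∑ i ∈ Finset.Ico n₀ m, b i) (2 * T₀ + 1) with h | h
      · exact ⟨n₀, le_rfl, hm, hx₀, h, id⟩
      · obtain ⟨n, h1, h2, h3⟩ := exists_sum_Ico_mem_Icc
          (fun i hi => (hbδ i hi).trans (min_le_right _ _)) hT₀.le (by linarith) hm
        have hsplit := Finset.sum_Ico_consecutive b h1 h2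
        have hlt : n < m := by
          rcases h2.eq_or_lt with h4 | h4
          · rw [h4] at h3; simp at h3; linarith
          · exact h4
        exact ⟨n, h1, h2, (ih n hlt h1 (hlt.le.trans hmN)).2 (by linarith [h3.2]),
          by linarith [h3.2], fun _ => h3.1⟩
    obtain ⟨y, hy, hy0, -⟩ := hUA hnU
    have hclose := htrack x b n m y hy hy0 hb
      (fun i hi => (hbδ i (hn₀.trans hi)).trans (min_le_left _ _)) (hρ _ hnU) hnm hnT
      (fun j h1 h2 => (hdef n j hn₀ h1 (h2.trans hmN) (le_trans
        (Finset.sum_le_sum_of_subset_of_nonneg (Finset.Ico_subset_Ico_right h2)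
          fun i _ _ => hb i) hnT)).trans (min_le_left _ _))
    set s := ∑ i ∈ Finset.Ico n m, b i with hs
    refine ⟨?_, fun h => hD _ (hxD m hm hmN) ?_⟩
    · have h1 := hy.norm_le hF (hy0 ▸ hρ _ hnU) (hsum0 n m) hnT
      have h2 := norm_le_norm_sub_add (x m) (y s)
      linarith [min_le_left 1 (r / 2)]
    · have h1 := hatt y hy (hy0 ▸ hnU) s (hT₀n h)
      have h2 := Metric.infDist_le_infDist_add_dist (s := A) (x := x m) (y := y s)
      rw [dist_eq_norm] at h2
      linarith [min_le_right 1 (r / 2)]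

theorem tendsto_sum_Ico_atTop {b : ℕ → ℝ} (hb : ∀ i, 0 ≤ b i) (hbs : ¬ Summable b) (n₀ : ℕ) :
    Tendsto (fun m => ∑ i ∈ Finset.Ico n₀ m, b i) atTop atTop := by
  have h1 := (not_summable_iff_tendsto_nat_atTop_of_nonneg hb).1 hbs
  have h2 := tendsto_atTop_add_const_right _ (-∑ i ∈ Finset.range n₀, b i) h1
  refine h2.congr' ?_
  filter_upwards [eventually_ge_atTop n₀] with m hm
  rw [Finset.sum_Ico_eq_sub _ hm, sub_eq_add_neg]

/-- Compare `x m` with the solution restarted between `T₀` and `T₀ + 1` time units earlier: uniform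
attraction brings that solution near `A`, and the late defects are too small to matter. -/
theorem tendsto_infDist_of_eulerDefect (hF : LipschitzWith L F) {A U : Set X} (hU : IsCompact U)
    (hUA : U ⊆ domainOfAttraction F A) (hA : LyapunovStable F A) {x : ℕ → X} {b : ℕ → ℝ}
    (hb : ∀ i, 0 ≤ b i) (hb0 : Tendsto b atTop (𝓝 0)) (hbs : ¬ Summable b)
    (hxU : ∀ᶠ n in atTop, x n ∈ U)
    (hdef : ∀ T δ : ℝ, 0 < δ → ∀ᶠ n in atTop, ∀ m, n ≤ m → ∑ i ∈ Finset.Ico n m, b i ≤ T →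
      ‖eulerDefect F b x n m‖ ≤ δ) :
    Tendsto (fun n => Metric.infDist (x n) A) atTop (𝓝 0) := by
  obtain ⟨ρ, hρ⟩ := hU.isBounded.exists_norm_le
  refine Metric.tendsto_nhds.2 fun ε hε => ?_
  obtain ⟨T₀, hT₀, hatt⟩ := exists_forall_infDist_lt hF hU hUA hA (half_pos hε)
  obtain ⟨δ, hδ, htrack⟩ := exists_norm_sub_le_of_eulerDefect hF ρ (T := T₀ + 1)
    (η := ε / 2) (by positivity)
  obtain ⟨n₀, hn₀⟩ := eventually_atTop.1 ((hxU.and (hdef (T₀ + 1) δ hδ)).and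
    ((hb0.eventually_le_const hδ).and (hb0.eventually_le_const one_pos)))
  have hlim := tendsto_sum_Ico_atTop hb hbs n₀
  filter_upwards [hlim.eventually_ge_atTop T₀, eventually_ge_atTop n₀] with m hm hm₀
  obtain ⟨n, h1, h2, h3⟩ := exists_sum_Ico_mem_Icc (fun i hi => (hn₀ i hi).2.2) hT₀.le hm hm₀
  obtain ⟨⟨hnU, hndef⟩, -⟩ := hn₀ n h1
  obtain ⟨y, hy, hy0, -⟩ := hUA hnU
  have hclose := htrack x b n m y hy hy0 hb (fun i hi => (hn₀ i (h1.trans hi)).2.1) (hρ _ hnU) h2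
    h3.2 (fun j h4 h5 => hndef j h4 (le_trans (Finset.sum_le_sum_of_subset_of_nonneg
      (Finset.Ico_subset_Ico_right h5) fun i _ _ => hb i) h3.2))
  have h4 := hatt y hy (hy0 ▸ hnU) _ h3.1
  have h5 := Metric.infDist_le_infDist_add_dist (s := A) (x := x m)
    (y := y (∑ i ∈ Finset.Ico n m, b i))
  rw [dist_eq_norm] at h5
  rw [Real.dist_0_eq_abs, abs_of_nonneg Metric.infDist_nonneg]
  linarith

end DiscreteTracking

/-! ### Fourth-moment maximal inequality for bounded martingale differences -/

section MartingaleDifferences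

variable {Ω : Type*} {m0 : MeasurableSpace Ω} {μ : Measure Ω} {𝒢 : Filtration ℕ m0}

/-- The partial sums of a process. -/
abbrev partialSum {V : Type*} [AddCommMonoid V] (D : ℕ → Ω → V) (n : ℕ) (ω : Ω) : V :=
  ∑ i ∈ Finset.range n, D i ω

/-- `D 0, D 1, …` are bounded martingale differences: `D n` is `𝒢 (n + 1)`-measurable, bounded by
`c n`, and has zero mean on the events of `𝒢 n`. -/
structure IsBoundedDifference {V : Type*} [NormedAddCommGroup V] [NormedSpace ℝ V]
    [MeasurableSpace V] (μ : Measure Ω) (𝒢 : Filtration ℕ m0) (D : ℕ → Ω → V) (c : ℕ → ℝ) :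
    Prop where
  measurable : ∀ n, Measurable[𝒢 (n + 1)] (D n)
  bound : ∀ n, ∀ᵐ ω ∂μ, ‖D n ω‖ ≤ c n
  setIntegral_eq_zero : ∀ n A, MeasurableSet[𝒢 n] A → ∫ ω in A, D n ω ∂μ = 0

namespace IsBoundedDifference

variable {D : ℕ → Ω → ℝ} {c : ℕ → ℝ}

theorem stronglyMeasurable_partialSum (h : IsBoundedDifference μ 𝒢 D c) (n : ℕ) :
    StronglyMeasurable[𝒢 n] (partialSum D n) := by
  refine Measurable.stronglyMeasurable ?_
  refine Finset.measurable_sum _ fun i hi => (h.measurable i).mono (𝒢.mono ?_) le_rfl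
  have := Finset.mem_range.1 hi
  omega

theorem abs_partialSum_le (h : IsBoundedDifference μ 𝒢 D c) (n : ℕ) :
    ∀ᵐ ω ∂μ, |partialSum D n ω| ≤ ∑ i ∈ Finset.range n, c i := by
  filter_upwards [ae_all_iff.2 h.bound] with ω hω
  exact (Finset.abs_sum_le_sum_abs _ _).trans (Finset.sum_le_sum fun i _ => hω i)

theorem integrable_mul [IsFiniteMeasure μ] (h : IsBoundedDifference μ 𝒢 D c) (n p q : ℕ) :
    Integrable (fun ω => partialSum D n ω ^ p * D n ω ^ q) μ := by
  have h1 := ((h.stronglyMeasurable_partialSum n).mono (𝒢.le n)).pow p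
  have h2 := ((h.measurable n).mono (𝒢.le _) le_rfl).stronglyMeasurable.pow q
  refine Integrable.of_bound (h1.mul h2).aestronglyMeasurable
    ((∑ i ∈ Finset.range n, c i) ^ p * c n ^ q) ?_
  filter_upwards [h.abs_partialSum_le n, h.bound n] with ω h3 h4
  simp only [norm_mul, norm_pow]
  rw [Real.norm_eq_abs] at h4 ⊢
  rw [Real.norm_eq_abs]
  have := (abs_nonneg _).trans h3
  gcongr

theorem integrable_pow [IsFiniteMeasure μ] (h : IsBoundedDifference μ 𝒢 D c) (n p : ℕ) :
    Integrable (fun ω => partialSum D n ω ^ p) μ := by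
  simpa using h.integrable_mul n p 0

/-- The power of the partial sum is `𝒢 n`-measurable and factors out of the conditional expectation
of `D n`, which vanishes. -/
theorem setIntegral_pow_mul_eq_zero [IsFiniteMeasure μ] (h : IsBoundedDifference μ 𝒢 D c)
    (n p : ℕ) {A : Set Ω} (hA : MeasurableSet[𝒢 n] A) :
    ∫ ω in A, partialSum D n ω ^ p * D n ω ∂μ = 0 := by
  have hDi : Integrable (D n) μ := by simpa using h.integrable_mul n 0 1
  have h0 : (0 : Ω → ℝ) =ᵐ[μ] μ[D n | 𝒢 n] :=
    ae_eq_condExp_of_forall_setIntegral_eq (𝒢.le n) hDi (fun _ _ _ => integrableOn_zero)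
      (fun s hs _ => by simp [h.setIntegral_eq_zero n s hs])
      stronglyMeasurable_zero.aestronglyMeasurable
  have h1 := condExp_mul_of_stronglyMeasurable_left (m := 𝒢 n) (μ := μ)
    ((h.stronglyMeasurable_partialSum n).pow p)
    (by simpa [Pi.mul_def] using h.integrable_mul n p 1) hDi
  have h2 := setIntegral_condExp (𝒢.le n) (μ := μ)
    (f := (partialSum D n) ^ p * D n) (by simpa [Pi.mul_def] using h.integrable_mul n p 1) hA
  have h3 : ∫ ω in A, (μ[(partialSum D n) ^ p * D n | 𝒢 n]) ω ∂μ = 0 := by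
    rw [integral_eq_zero_of_ae]
    refine ae_restrict_of_ae ?_
    filter_upwards [h0, h1] with ω h4 h5
    rw [h5, Pi.mul_apply, ← h4]
    simp
  rw [h3] at h2
  simpa using h2.symm

theorem partialSum_succ (D : ℕ → Ω → ℝ) (n : ℕ) (ω : Ω) :
    partialSum D (n + 1) ω = partialSum D n ω + D n ω := Finset.sum_range_succ _ _

theorem integral_sq_le [IsProbabilityMeasure μ] (h : IsBoundedDifference μ 𝒢 D c) (n : ℕ) :
    ∫ ω, partialSum D n ω ^ 2 ∂μ ≤ ∑ i ∈ Finset.range n, c i ^ 2 := by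
  induction n with
  | zero => simp [partialSum]
  | succ n ih =>
    have h1 := h.setIntegral_pow_mul_eq_zero n 1 MeasurableSet.univ
    rw [setIntegral_univ] at h1
    have h2 : ∫ ω, D n ω ^ 2 ∂μ ≤ c n ^ 2 := by
      have := integral_mono_ae (by simpa using h.integrable_mul n 0 2)
        (integrable_const (c n ^ 2)) (μ := μ) (f := fun ω => D n ω ^ 2) (by
          filter_upwards [h.bound n] with ω hω
          simp only [← sq_abs (D n ω)]
          rw [Real.norm_eq_abs] at hω
          gcongr)
      simpa using this
    calc ∫ ω, partialSum D (n + 1) ω ^ 2 ∂μ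
        = ∫ ω, (partialSum D n ω ^ 2 + 2 * (partialSum D n ω ^ 1 * D n ω) + D n ω ^ 2) ∂μ := by
          congr 1; ext ω; rw [partialSum_succ]; ring
      _ = ∫ ω, partialSum D n ω ^ 2 ∂μ + ∫ ω, D n ω ^ 2 ∂μ := by
          rw [integral_add, integral_add, integral_const_mul, h1]
          · ring
          · exact h.integrable_pow n 2
          · exact (by simpa using h.integrable_mul n 1 1 : Integrable _ μ).const_mul 2
          · exact (h.integrable_pow n 2).add
              ((by simpa using h.integrable_mul n 1 1 : Integrable _ μ).const_mul 2)
          · simpa using h.integrable_mul n 0 2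
      _ ≤ _ := by rw [Finset.sum_range_succ]; gcongr

/-- In the expansion of `(s + D) ^ 4` the term `s ^ 3 * D` has mean zero, and `4 * s * D ^ 3 ≤ 2 * s
^ 2 * D ^ 2 + 2 * D ^ 4`. With the second-moment bound the increment is at most `8 * c ^ 2 * Σ + 3 *
c ^ 4`, which fits into `4 * (Σ + c ^ 2) ^ 2 - 4 * Σ ^ 2`. -/
theorem integral_pow_four_le [IsProbabilityMeasure μ] (h : IsBoundedDifference μ 𝒢 D c) (n : ℕ) :
    ∫ ω, partialSum D n ω ^ 4 ∂μ ≤ 4 * (∑ i ∈ Finset.range n, c i ^ 2) ^ 2 := by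
  induction n with
  | zero => simp [partialSum]
  | succ n ih =>
    have h1 := h.setIntegral_pow_mul_eq_zero n 3 MeasurableSet.univ
    rw [setIntegral_univ] at h1
    have h2 := h.integral_sq_le n
    have i2 := (h.integrable_pow n 2).const_mul (8 * c n ^ 2)
    have i3 : Integrable (fun ω => 4 * (partialSum D n ω ^ 3 * D n ω)) μ :=
      (by simpa using h.integrable_mul n 3 1 : Integrable _ μ).const_mul 4
    have i4 := h.integrable_pow n 4
    have h3 : ∫ ω, partialSum D (n + 1) ω ^ 4 ∂μ ≤
        ∫ ω, (partialSum D n ω ^ 4 + 4 * (partialSum D n ω ^ 3 * D n ω) +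
          8 * c n ^ 2 * partialSum D n ω ^ 2 + 3 * c n ^ 4) ∂μ := by
      refine integral_mono_ae (h.integrable_pow (n + 1) 4)
        (((i4.add i3).add i2).add (integrable_const _)) ?_
      filter_upwards [h.bound n] with ω hω
      simp only [partialSum_succ]
      set s := partialSum D n ω
      rw [Real.norm_eq_abs] at hω
      have hd : D n ω ^ 2 ≤ c n ^ 2 := by rw [← sq_abs]; gcongr
      have hd4 : D n ω ^ 4 ≤ c n ^ 4 := by
        calc D n ω ^ 4 = (D n ω ^ 2) ^ 2 := by ring
          _ ≤ (c n ^ 2) ^ 2 := by gcongr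
          _ = _ := by ring
      nlinarith [sq_nonneg (s * D n ω - D n ω ^ 2), mul_le_mul_of_nonneg_left hd (sq_nonneg s)]
    refine h3.trans ?_
    rw [integral_add (by exact (i4.add i3).add i2) (integrable_const _),
      integral_add (by exact i4.add i3) i2, integral_add i4 i3, integral_const_mul, integral_const_mul, h1, Finset.sum_range_succ]
    simp only [integral_const, probReal_univ, smul_eq_mul, one_mul, mul_zero, add_zero]
    nlinarith [mul_le_mul_of_nonneg_left h2 (by positivity : 0 ≤ 8 * c n ^ 2),
      sq_nonneg (c n ^ 2)]

/-- Apart from the centred term `4 * s ^ 3 * D`, the increment is `D ^ 2 * ((2 * s + D) ^ 2 + 2 * s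
^ 2) ≥ 0`. -/
theorem submartingale_pow_four [IsFiniteMeasure μ] (h : IsBoundedDifference μ 𝒢 D c) :
    Submartingale (fun n ω => partialSum D n ω ^ 4) 𝒢 μ := by
  refine submartingale_of_setIntegral_le_succ
    (fun n => (h.stronglyMeasurable_partialSum n).pow 4) (fun n => h.integrable_pow n 4)
    fun n A hA => ?_
  have i3 : Integrable (fun ω => 4 * (partialSum D n ω ^ 3 * D n ω)) μ :=
    (by simpa using h.integrable_mul n 3 1 : Integrable _ μ).const_mul 4
  calc ∫ ω in A, partialSum D n ω ^ 4 ∂μ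
      = ∫ ω in A, (partialSum D n ω ^ 4 + 4 * (partialSum D n ω ^ 3 * D n ω)) ∂μ := by
        rw [integral_add (h.integrable_pow n 4).integrableOn i3.integrableOn, integral_const_mul,
          h.setIntegral_pow_mul_eq_zero n 3 hA]
        simp
    _ ≤ _ := by
        refine integral_mono ((h.integrable_pow n 4).add i3).integrableOn
          (h.integrable_pow (n + 1) 4).integrableOn fun ω => ?_
        simp only [partialSum_succ]
        set s := partialSum D n ω
        nlinarith [mul_nonneg (sq_nonneg (D n ω)) (add_nonneg (sq_nonneg (2 * s + D n ω))
          (sq_nonneg s)), sq_nonneg (s * D n ω)]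

/-- Doob's inequality for the fourth powers on each finite horizon, then monotone continuity. The
square of `σ` is what later makes the error negligible against `tailSq`. -/
theorem measure_exists_le_abs_partialSum [IsProbabilityMeasure μ]
    (h : IsBoundedDifference μ 𝒢 D c) {σ δ : ℝ} (hδ : 0 < δ)
    (hσ : ∀ n, ∑ i ∈ Finset.range n, c i ^ 2 ≤ σ) :
    μ {ω | ∃ k, δ ≤ |partialSum D k ω|} ≤ ENNReal.ofReal (4 * σ ^ 2 / δ ^ 4) := by
  have hσ0 : 0 ≤ σ := by simpa using hσ 0
  set E : ℕ → Set Ω := fun n => {ω | ∃ k, k ≤ n ∧ δ ≤ |partialSum D k ω|} with hE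
  have hmono : Monotone E := fun i j hij ω ⟨k, hk, hk'⟩ => ⟨k, hk.trans hij, hk'⟩
  have hU : {ω | ∃ k, δ ≤ |partialSum D k ω|} = ⋃ n, E n := by
    ext ω
    simp only [Set.mem_ofPred_eq, Set.mem_iUnion, E]
    exact ⟨fun ⟨k, hk⟩ => ⟨k, k, le_rfl, hk⟩, fun ⟨_, k, _, hk⟩ => ⟨k, hk⟩⟩
  rw [hU, hmono.measure_iUnion]
  refine iSup_le fun n => ?_
  set ε : NNReal := ⟨δ ^ 4, by positivity⟩ with hε
  set E' := {ω | δ ^ 4 ≤ (Finset.range (n + 1)).sup' Finset.nonempty_range_add_one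
    fun k => partialSum D k ω ^ 4} with hE'
  have hmax : (ε : ENNReal) * μ E' ≤ ENNReal.ofReal (∫ ω in E', partialSum D n ω ^ 4 ∂μ) :=
    maximal_ineq h.submartingale_pow_four (fun n ω => by positivity) n
  have hEE' : E n ⊆ E' := by
    rintro ω ⟨k, hk, hkδ⟩
    refine (?_ : δ ^ 4 ≤ partialSum D k ω ^ 4).trans (Finset.le_sup'
      (fun k => partialSum D k ω ^ 4) (Finset.mem_range.2 (Nat.lt_succ_of_le hk)))
    rw [← (by decide : Even 4).pow_abs (partialSum D k ω)]
    gcongr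
  have hint : ∫ ω in E', partialSum D n ω ^ 4 ∂μ ≤ 4 * σ ^ 2 := by
    refine (setIntegral_le_integral (h.integrable_pow n 4)
      (Eventually.of_forall fun ω => by positivity)).trans ((h.integral_pow_four_le n).trans ?_)
    have h0 : 0 ≤ ∑ i ∈ Finset.range n, c i ^ 2 := Finset.sum_nonneg fun i _ => sq_nonneg _
    have := hσ n
    gcongr
  rw [ENNReal.ofReal_div_of_pos (by positivity), ENNReal.le_div_iff_mul_le
    (Or.inl (by simpa using pow_pos hδ 4)) (Or.inl ENNReal.ofReal_ne_top), mul_comm,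
    ENNReal.ofReal_eq_coe_nnreal (by positivity : 0 ≤ δ ^ 4)]
  calc (ε : ENNReal) * μ (E n) ≤ ε * μ E' := by gcongr
    _ ≤ ENNReal.ofReal (∫ ω in E', partialSum D n ω ^ 4 ∂μ) := hmax
    _ ≤ _ := ENNReal.ofReal_le_ofReal hint

/-- Since `|s| ≤ 1 + s ^ 2`, the second-moment bound gives boundedness in `L¹`, and martingale
convergence applies. -/
theorem ae_exists_tendsto_partialSum_real [IsProbabilityMeasure μ]
    (h : IsBoundedDifference μ 𝒢 D c) {σ : ℝ} (hσ : ∀ n, ∑ i ∈ Finset.range n, c i ^ 2 ≤ σ) :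
    ∀ᵐ ω ∂μ, ∃ l, Tendsto (fun n => partialSum D n ω) atTop (𝓝 l) := by
  have hi : ∀ n, Integrable (partialSum D n) μ := fun n => by simpa using h.integrable_pow n 1
  have hsub : Submartingale (partialSum D) 𝒢 μ := by
    refine submartingale_of_setIntegral_le_succ h.stronglyMeasurable_partialSum hi
      fun n A hA => ?_
    have hDi : Integrable (D n) μ := by simpa using h.integrable_mul n 0 1
    simp only [partialSum_succ]
    rw [integral_add (hi n).integrableOn hDi.integrableOn, h.setIntegral_eq_zero n A hA, add_zero]
  refine hsub.exists_ae_tendsto_of_bdd (R := (1 + σ).toNNReal) fun n => ?_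
  rw [eLpNorm_one_eq_lintegral_enorm, ← ofReal_integral_norm_eq_lintegral_enorm (hi n)]
  refine ENNReal.ofReal_le_ofReal ?_
  calc ∫ ω, ‖partialSum D n ω‖ ∂μ ≤ ∫ ω, (1 + partialSum D n ω ^ 2) ∂μ := by
        refine integral_mono (hi n).norm ((integrable_const _).add (h.integrable_pow n 2))
          fun ω => ?_
        simp only [Real.norm_eq_abs, ← sq_abs (partialSum D n ω)]
        nlinarith [sq_nonneg (|partialSum D n ω| - 1), abs_nonneg (partialSum D n ω)]
    _ ≤ 1 + σ := by
        rw [integral_add (integrable_const _) (h.integrable_pow n 2)]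
        simpa using (h.integral_sq_le n).trans (hσ n)

theorem apply {d : ℕ} {D : ℕ → Ω → EuclideanSpace ℝ (Fin d)} [IsFiniteMeasure μ]
    (h : IsBoundedDifference μ 𝒢 D c) (j : Fin d) :
    IsBoundedDifference μ 𝒢 (fun n ω => D n ω j) c where
  measurable n := (by fun_prop : Measurable fun x : EuclideanSpace ℝ (Fin d) => x j).comp
    (h.measurable n)
  bound n := by
    filter_upwards [h.bound n] with ω hω
    exact (PiLp.norm_apply_le _ _).trans hω
  setIntegral_eq_zero n A hA := by
    have hi : Integrable (D n) μ := Integrable.of_bound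
      (((h.measurable n).mono (𝒢.le _) le_rfl).aestronglyMeasurable) (c n) (h.bound n)
    have := ContinuousLinearMap.integral_comp_comm (μ := μ.restrict A)
      (EuclideanSpace.proj j : EuclideanSpace ℝ (Fin d) →L[ℝ] ℝ) hi.integrableOn
    simpa [h.setIntegral_eq_zero n A hA] using this

theorem norm_euclidean_le_sum {d : ℕ} (x : EuclideanSpace ℝ (Fin d)) : ‖x‖ ≤ ∑ j, |x j| := by
  rw [EuclideanSpace.norm_eq]
  refine Real.sqrt_le_iff.2 ⟨Finset.sum_nonneg fun j _ => abs_nonneg _, ?_⟩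
  simp only [Real.norm_eq_abs]
  exact Finset.sum_sq_le_sq_sum_of_nonneg fun j _ => abs_nonneg _

theorem partialSum_apply {d : ℕ} (D : ℕ → Ω → EuclideanSpace ℝ (Fin d)) (n : ℕ) (ω : Ω)
    (j : Fin d) : partialSum D n ω j = partialSum (fun n ω => D n ω j) n ω := by
  simp [partialSum]

theorem measure_exists_le_norm_partialSum [IsProbabilityMeasure μ] {d : ℕ}
    {D : ℕ → Ω → EuclideanSpace ℝ (Fin d)} (h : IsBoundedDifference μ 𝒢 D c) {σ δ : ℝ}
    (hδ : 0 < δ) (hσ : ∀ n, ∑ i ∈ Finset.range n, c i ^ 2 ≤ σ) :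
    μ {ω | ∃ k, δ ≤ ‖partialSum D k ω‖} ≤
      ENNReal.ofReal (d * (4 / (δ / (d + 1)) ^ 4) * σ ^ 2) := by
  -- If all coordinates are below `δ / (d + 1)`, the norm is below `δ`; `d + 1` keeps this strict
  -- and also covers `d = 0`.
  have hsub : {ω | ∃ k, δ ≤ ‖partialSum D k ω‖} ⊆ ⋃ j ∈ (Finset.univ : Finset (Fin d)),
      {ω | ∃ k, δ / (d + 1) ≤ |partialSum (fun n ω => D n ω j) k ω|} := by
    rintro ω ⟨k, hk⟩
    by_contra hcon
    simp only [Set.mem_iUnion, Set.mem_ofPred_eq, Finset.mem_univ, exists_prop, true_and,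
      not_exists, not_le] at hcon
    have h1 : ‖partialSum D k ω‖ ≤ d * (δ / (d + 1)) := by
      refine (norm_euclidean_le_sum _).trans ?_
      calc _ ≤ ∑ _j : Fin d, δ / (d + 1) := Finset.sum_le_sum fun j _ => by
            rw [partialSum_apply]; exact (hcon j k).le
        _ = _ := by simp
    have h2 : (d : ℝ) * (δ / (d + 1)) < δ := by
      rw [mul_div_assoc', div_lt_iff₀ (by positivity)]; nlinarith
    linarith
  calc _ ≤ ∑ j : Fin d, ENNReal.ofReal (4 * σ ^ 2 / (δ / (d + 1)) ^ 4) :=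
        (measure_mono hsub).trans ((measure_biUnion_finset_le _ _).trans
          (Finset.sum_le_sum fun j _ => (h.apply j).measure_exists_le_abs_partialSum
            (by positivity) hσ))
    _ = _ := by
        rw [Finset.sum_const, Finset.card_univ, Fintype.card_fin, nsmul_eq_mul,
          ← ENNReal.ofReal_natCast, ← ENNReal.ofReal_mul (by positivity)]
        congr 1; ring

theorem ae_exists_tendsto_partialSum [IsProbabilityMeasure μ] {d : ℕ}
    {D : ℕ → Ω → EuclideanSpace ℝ (Fin d)} (h : IsBoundedDifference μ 𝒢 D c) {σ : ℝ}
    (hσ : ∀ n, ∑ i ∈ Finset.range n, c i ^ 2 ≤ σ) :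
    ∀ᵐ ω ∂μ, ∃ l, Tendsto (fun n => partialSum D n ω) atTop (𝓝 l) := by
  filter_upwards [ae_all_iff.2 fun j => (h.apply j).ae_exists_tendsto_partialSum_real hσ] with ω hω
  choose l hl using hω
  refine ⟨WithLp.toLp 2 l, ?_⟩
  have h1 : Tendsto (fun n => (partialSum D n ω).ofLp) atTop (𝓝 l) := by
    refine tendsto_pi_nhds.2 fun j => ?_
    simpa only [partialSum_apply] using hl j
  exact ((PiLp.continuous_toLp 2 _).tendsto l).comp h1

/-- The tail of a sequence of bounded martingale differences, conditionally on an event of the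
past. -/
theorem shift_cond [IsProbabilityMeasure μ] {V : Type*} [NormedAddCommGroup V] [NormedSpace ℝ V]
    [MeasurableSpace V] {D : ℕ → Ω → V} (h : IsBoundedDifference μ 𝒢 D c) {n₀ : ℕ} {B : Set Ω}
    (hB : MeasurableSet[𝒢 n₀] B) :
    IsBoundedDifference (μ[|B]) (⟨fun n => 𝒢 (n₀ + n), fun i j hij => 𝒢.mono (by omega),
      fun n => 𝒢.le _⟩ : Filtration ℕ m0) (fun n => D (n₀ + n)) (fun n => c (n₀ + n)) where
  measurable n := h.measurable (n₀ + n)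
  bound n := cond_absolutelyContinuous (h.bound (n₀ + n))
  setIntegral_eq_zero n A hA := by
    have hA' : MeasurableSet A := 𝒢.le _ _ hA
    rw [ProbabilityTheory.cond, Measure.restrict_smul, integral_smul_measure, Measure.restrict_restrict hA',
      h.setIntegral_eq_zero (n₀ + n) _ (hA.inter (𝒢.mono (by omega) _ hB)), smul_zero]

/-- Conditioning on `B` preserves the martingale difference property after `n₀`, so the maximal
inequality holds under `μ[|B]`. The product form also makes sense for null `B`. -/
theorem measure_inter_exists_le_norm_sum_Ico [IsProbabilityMeasure μ] {d : ℕ}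
    {D : ℕ → Ω → EuclideanSpace ℝ (Fin d)} (h : IsBoundedDifference μ 𝒢 D c) {σ δ : ℝ}
    (hδ : 0 < δ) {n₀ : ℕ} (hσ : ∀ n, ∑ i ∈ Finset.range n, c (n₀ + i) ^ 2 ≤ σ) {B : Set Ω}
    (hB : MeasurableSet[𝒢 n₀] B) :
    μ (B ∩ {ω | ∃ k, δ ≤ ‖∑ i ∈ Finset.Ico n₀ k, D i ω‖}) ≤
      ENNReal.ofReal (d * (4 / (δ / (d + 1)) ^ 4) * σ ^ 2) * μ B := by
  rcases eq_or_ne (μ B) 0 with h0 | h0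
  · rw [measure_mono_null Set.inter_subset_left h0]; exact zero_le
  have hprob : IsProbabilityMeasure (μ[|B]) := cond_isProbabilityMeasure h0
  have h1 := (h.shift_cond hB).measure_exists_le_norm_partialSum hδ hσ
  rw [cond_apply (𝒢.le _ _ hB), ENNReal.inv_mul_le_iff h0 (measure_ne_top _ _), mul_comm] at h1
  refine le_trans (measure_mono (Set.inter_subset_inter_right _ ?_)) h1
  rintro ω ⟨k, hk⟩
  refine ⟨k - n₀, ?_⟩
  rwa [Finset.sum_Ico_eq_sum_range] at hk

end IsBoundedDifference

end MartingaleDifferences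

/-! ### From conditional probabilities of events to integrals against the kernel -/

section MarkovNoise

variable {Ω X S V : Type*} {m0 : MeasurableSpace Ω} {P : Measure Ω} [IsProbabilityMeasure P]
  {𝒢 : Filtration ℕ m0} [MeasurableSpace X] [MeasurableSpace S]
  {Pi : Kernel (X × S) S} [IsMarkovKernel Pi] {x : ℕ → Ω → X} {Z : ℕ → Ω → S}

/-- Both sides agree on rectangles, by integrating the Markov property over events of `𝒢 n`. This
upgrades a statement about one event at a time to one about joint laws. -/
theorem IsMarkovNoise.map_eq_compProd (h : IsMarkovNoise P (fun n => 𝒢 n) Pi x Z)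
    (hx : ∀ n, Measurable[𝒢 n] (x n)) (hZ : ∀ n, Measurable[𝒢 n] (Z n)) (n : ℕ) {A : Set Ω}
    (hA : MeasurableSet[𝒢 n] A) :
    (P.restrict A).map (fun ω => ((x n ω, Z n ω), Z (n + 1) ω)) =
      ((P.restrict A).map (fun ω => (x n ω, Z n ω))) ⊗ₘ Pi := by
  have hxZ : Measurable[𝒢 n] (fun ω => (x n ω, Z n ω)) := (hx n).prodMk (hZ n)
  have hxZ' : Measurable (fun ω => (x n ω, Z n ω)) := hxZ.mono (𝒢.le n) le_rfl
  have hZ' : Measurable (Z (n + 1)) := (hZ (n + 1)).mono (𝒢.le _) le_rfl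
  have : IsFiniteMeasure ((P.restrict A).map (fun ω => ((x n ω, Z n ω), Z (n + 1) ω))) :=
    Measure.isFiniteMeasure_map _ _
  refine Measure.ext_prod fun {s t} hs ht => ?_
  have hs' : MeasurableSet[𝒢 n] ((fun ω => (x n ω, Z n ω)) ⁻¹' s) := hxZ hs
  have hmeas : Measurable fun p => Pi p t := Pi.measurable_coe ht
  have hcond := setIntegral_condExp (𝒢.le n) (μ := P)
    (f := (Z (n + 1) ⁻¹' t).indicator (fun _ => (1 : ℝ)))
    ((integrable_const _).indicator (hZ' ht)) (hs'.inter hA)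
  rw [setIntegral_congr_ae (g := fun ω => (Pi (x n ω, Z n ω)).real t) (𝒢.le n _ (hs'.inter hA))
    ((h n t ht).mono fun ω hω _ => hω), integral_indicator_const _ (hZ' ht), smul_eq_mul, mul_one,
    measureReal_restrict_apply (hZ' ht)] at hcond
  rw [Measure.compProd_apply_prod hs ht, Measure.map_apply (hxZ'.prodMk hZ') (hs.prod ht),
    setLIntegral_map hs hmeas hxZ', Measure.restrict_restrict (hxZ' hs),
    Measure.restrict_apply ((hxZ'.prodMk hZ') (hs.prod ht))]
  have h1 : ∫⁻ ω in (fun ω => (x n ω, Z n ω)) ⁻¹' s ∩ A, Pi (x n ω, Z n ω) t ∂P =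
      ENNReal.ofReal (∫ ω in (fun ω => (x n ω, Z n ω)) ⁻¹' s ∩ A, (Pi (x n ω, Z n ω)).real t ∂P) := by
    rw [ofReal_integral_eq_lintegral_ofReal]
    · simp [measureReal_def]
    · refine Integrable.of_bound
        ((hmeas.comp hxZ').ennreal_toReal).aestronglyMeasurable 1 (Eventually.of_forall fun ω => ?_)
      rw [Real.norm_of_nonneg measureReal_nonneg]
      exact measureReal_le_one
    · exact Eventually.of_forall fun ω => measureReal_nonneg
  rw [h1, hcond, ofReal_measureReal]
  congr 1
  ext ω
  simp only [Set.mem_inter_iff, Set.mem_preimage, Set.mem_prod]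
  tauto

/-- Transfers the almost sure bound on the noise to the transition kernel, so that the integral of
`v` against it is bounded as well. -/
theorem IsMarkovNoise.ae_apply_eq_one (h : IsMarkovNoise P (fun n => 𝒢 n) Pi x Z) (n : ℕ)
    {A : Set S} (hA : MeasurableSet A) (hZA : ∀ᵐ ω ∂P, Z (n + 1) ω ∈ A) :
    ∀ᵐ ω ∂P, Pi (x n ω, Z n ω) A = 1 := by
  have h1 : (Z (n + 1) ⁻¹' A).indicator (fun _ => (1 : ℝ)) =ᵐ[P] fun _ => (1 : ℝ) := by
    filter_upwards [hZA] with ω hω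
    exact Set.indicator_of_mem (s := Z (n + 1) ⁻¹' A) hω (fun _ => (1 : ℝ))
  have h2 := condExp_congr_ae (m := 𝒢 n) h1
  rw [condExp_const (𝒢.le n)] at h2
  filter_upwards [h n A hA, h2] with ω h3 h4
  have h5 : (Pi (x n ω, Z n ω)).real A = 1 := by rw [← h3]; exact h4
  rw [← ofReal_measureReal, h5, ENNReal.ofReal_one]

variable [NormedAddCommGroup V] [NormedSpace ℝ V] [MeasurableSpace V] [BorelSpace V]
  [SecondCountableTopology V]

/-- Fubini for the composition product; it makes `v (x n) (Z (n + 1))` minus its kernel average a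
martingale difference. -/
theorem IsMarkovNoise.setIntegral_eq (h : IsMarkovNoise P (fun n => 𝒢 n) Pi x Z)
    (hx : ∀ n, Measurable[𝒢 n] (x n)) (hZ : ∀ n, Measurable[𝒢 n] (Z n)) (n : ℕ) {A : Set Ω}
    (hA : MeasurableSet[𝒢 n] A) {v : X → S → V} (hv : Measurable (Function.uncurry v)) {C : ℝ}
    (hC : ∀ᵐ ω ∂P, ω ∈ A → ‖v (x n ω) (Z (n + 1) ω)‖ ≤ C) :
    ∫ ω in A, v (x n ω) (Z (n + 1) ω) ∂P =
      ∫ ω in A, ∫ s, v (x n ω) s ∂(Pi (x n ω, Z n ω)) ∂P := by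
  have hx' : Measurable (x n) := (hx n).mono (𝒢.le _) le_rfl
  have hZ0 : Measurable (Z n) := (hZ n).mono (𝒢.le _) le_rfl
  have hZ' : Measurable (Z (n + 1)) := (hZ (n + 1)).mono (𝒢.le _) le_rfl
  have hφ : Measurable (fun p : (X × S) × S => v p.1.1 p.2) :=
    hv.comp ((measurable_fst.comp measurable_fst).prodMk measurable_snd)
  have hm : Measurable (fun ω => ((x n ω, Z n ω), Z (n + 1) ω)) := (hx'.prodMk hZ0).prodMk hZ'
  have hmap := h.map_eq_compProd hx hZ n hA
  have hint : Integrable (fun p : (X × S) × S => v p.1.1 p.2)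
      ((P.restrict A).map (fun ω => ((x n ω, Z n ω), Z (n + 1) ω))) := by
    rw [integrable_map_measure hφ.aestronglyMeasurable hm.aemeasurable]
    exact Integrable.of_bound (hφ.comp hm).aestronglyMeasurable C
      ((ae_restrict_iff' (𝒢.le n _ hA)).2 hC)
  have h1 := integral_map hm.aemeasurable (μ := P.restrict A) hφ.aestronglyMeasurable
  rw [hmap] at hint h1
  rw [Measure.integral_compProd hint] at h1
  have h2 : StronglyMeasurable fun p : X × S => ∫ s, v p.1 s ∂(Pi p) :=
    StronglyMeasurable.integral_kernel_prod_right' (κ := Pi)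
      (f := fun p : (X × S) × S => v p.1.1 p.2) hφ.stronglyMeasurable
  rw [integral_map (hx'.prodMk hZ0).aemeasurable h2.aestronglyMeasurable] at h1
  exact h1.symm

end MarkovNoise

/-! ### Joint measurability of Poisson solutions -/

section Poisson

/-- A solution of the Poisson equation which is locally Lipschitz in the parameter is jointly
measurable. -/
theorem measurable_uncurry_of_locally_lipschitz {X S V : Type*} [NormedAddCommGroup X]
    [MeasurableSpace X] [OpensMeasurableSpace X] [SecondCountableTopology X]
    [NormedAddCommGroup S] [MeasurableSpace S] [NormedAddCommGroup V] [MeasurableSpace V]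
    [BorelSpace V] {v : X → S → V} (hv : ∀ x, Measurable (v x))
    (hlip : ∀ R : ℝ, 0 < R → ∃ C : ℝ, ∀ x x' s, ‖x‖ ≤ R → ‖x'‖ ≤ R →
      ‖v x s - v x' s‖ ≤ C * ‖x - x'‖ * (1 + ‖s‖)) : Measurable (Function.uncurry v) := by
  refine measurable_uncurry_of_continuous_of_measurable (fun s => ?_) hv
  refine continuous_iff_continuousAt.2 fun x₀ => ?_
  obtain ⟨C, hC⟩ := hlip (‖x₀‖ + 1) (by positivity)
  refine tendsto_iff_norm_sub_tendsto_zero.2 ?_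
  have h1 : Tendsto (fun x => C * ‖x - x₀‖ * (1 + ‖s‖)) (𝓝 x₀) (𝓝 0) := by
    have : Continuous fun x : X => C * ‖x - x₀‖ * (1 + ‖s‖) := by fun_prop
    simpa using this.tendsto x₀
  refine squeeze_zero' (Eventually.of_forall fun x => norm_nonneg _) ?_ h1
  filter_upwards [Metric.ball_mem_nhds x₀ one_pos] with x hx
  rw [mem_ball_iff_norm] at hx
  refine hC x x₀ s ?_ (by linarith)
  linarith [norm_le_norm_sub_add x x₀]

end Poisson

/-! ### Step sizes and Abel summation -/

section StepSizes

variable {b : ℕ → ℝ}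

theorem IsStepSize.nonneg (hb : IsStepSize b) (n : ℕ) : 0 ≤ b n := (hb.1 n).le

theorem IsStepSize.tendsto_zero (hb : IsStepSize b) : Tendsto b atTop (𝓝 0) := by
  have h1 := (hb.2.2.2.tendsto_atTop_zero).sqrt
  simpa [Real.sqrt_sq (hb.nonneg _)] using h1

theorem IsStepSize.summable_add (hb : IsStepSize b) (n : ℕ) :
    Summable fun i => b (n + i) ^ 2 := by
  have := (summable_nat_add_iff n).2 hb.2.2.2
  simpa only [add_comm] using this

theorem IsStepSize.tailSq_pos (hb : IsStepSize b) (n : ℕ) : 0 < tailSq b n :=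
  (hb.summable_add n).tsum_pos (fun _ => sq_nonneg _) 0 (pow_pos (hb.1 _) 2)

theorem tendsto_tailSq (b : ℕ → ℝ) : Tendsto (tailSq b) atTop (𝓝 0) := by
  have := tendsto_sum_nat_add fun i => b i ^ 2
  simpa only [add_comm, tailSq] using! this

theorem IsStepSize.sum_range_le (hb : IsStepSize b) (n m : ℕ) :
    ∑ i ∈ Finset.range m, b (n + i) ^ 2 ≤ tailSq b n :=
  (hb.summable_add n).sum_le_tsum _ fun _ _ => sq_nonneg _

theorem IsStepSize.sum_Ico_le (hb : IsStepSize b) (n m : ℕ) :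
    ∑ i ∈ Finset.Ico n m, b i ^ 2 ≤ tailSq b n := by
  rw [Finset.sum_Ico_eq_sum_range]; exact hb.sum_range_le n _

/-- Meant for `u i = v (x i) (Z i)` and `u' i = v (x i) (Z (i + 1))`. Abel summation with monotone
weights bounds the telescoping part by `2 * c * b n`; the mismatch of parameters adds at most `c' *
b i ^ 2` per step. -/
theorem norm_sum_smul_sub_le {V : Type*} [NormedAddCommGroup V] [NormedSpace ℝ V]
    (hb : IsStepSize b) {u u' : ℕ → V} {n m : ℕ} {c c' : ℝ} (hc' : 0 ≤ c')
    (hu : ∀ i, n ≤ i → i ≤ m → ‖u i‖ ≤ c)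
    (hu' : ∀ i, n ≤ i → i < m → ‖u (i + 1) - u' i‖ ≤ c' * b i) (hnm : n ≤ m) :
    ‖∑ i ∈ Finset.Ico n m, b i • (u i - u' i)‖ ≤ 2 * c * b n + c' * tailSq b n := by
  -- With the boundary term added, the sum is `b n • u n` minus the terms `(b i - b (i + 1)) • u (i
  -- + 1)`, whose weights are nonnegative and add up to `b n - b j`.
  have key : ∀ j, n ≤ j → j ≤ m →
      ‖∑ i ∈ Finset.Ico n j, b i • (u i - u (i + 1)) + b j • u j‖ ≤
        c * b n + c * (b n - b j) := by
    intro j hnj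
    induction j, hnj using Nat.le_induction with
    | base =>
      intro _
      simp only [Finset.Ico_self, Finset.sum_empty, zero_add, sub_self, mul_zero, add_zero]
      rw [norm_smul, Real.norm_of_nonneg (hb.nonneg n), mul_comm]
      exact mul_le_mul_of_nonneg_right (hu n le_rfl hnm) (hb.nonneg n)
    | succ j hnj ih =>
      intro hjm
      have ih := ih (by omega)
      have hanti : b (j + 1) ≤ b j := hb.2.1 (Nat.le_succ j)
      calc ‖∑ i ∈ Finset.Ico n (j + 1), b i • (u i - u (i + 1)) + b (j + 1) • u (j + 1)‖
          = ‖(∑ i ∈ Finset.Ico n j, b i • (u i - u (i + 1)) + b j • u j) -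
              (b j - b (j + 1)) • u (j + 1)‖ := by
            rw [Finset.sum_Ico_succ_top hnj, smul_sub, sub_smul]; congr 1; abel
        _ ≤ (c * b n + c * (b n - b j)) + (b j - b (j + 1)) * c := by
            refine (norm_sub_le _ _).trans (add_le_add ih ?_)
            rw [norm_smul, Real.norm_of_nonneg (by linarith)]
            exact mul_le_mul_of_nonneg_left (hu _ (by omega) hjm) (by linarith)
        _ = _ := by ring
  have h1 : ‖∑ i ∈ Finset.Ico n m, b i • (u i - u (i + 1))‖ ≤ 2 * c * b n := by
    have h2 := key m hnm le_rfl
    have h3 : ‖b m • u m‖ ≤ b m * c := by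
      rw [norm_smul, Real.norm_of_nonneg (hb.nonneg m)]
      exact mul_le_mul_of_nonneg_left (hu m hnm le_rfl) (hb.nonneg m)
    have h4 := norm_sub_le (∑ i ∈ Finset.Ico n m, b i • (u i - u (i + 1)) + b m • u m) (b m • u m)
    rw [add_sub_cancel_right] at h4
    linarith
  have h2 : ‖∑ i ∈ Finset.Ico n m, b i • (u (i + 1) - u' i)‖ ≤ c' * tailSq b n := by
    calc _ ≤ ∑ i ∈ Finset.Ico n m, c' * b i ^ 2 := by
          refine norm_sum_le_of_le _ fun i hi => ?_
          rw [Finset.mem_Ico] at hi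
          rw [norm_smul, Real.norm_of_nonneg (hb.nonneg i), sq, ← mul_assoc, mul_comm (b i)]
          exact mul_le_mul_of_nonneg_right (hu' i hi.1 hi.2) (hb.nonneg i)
      _ = c' * ∑ i ∈ Finset.Ico n m, b i ^ 2 := by rw [Finset.mul_sum]
      _ ≤ _ := mul_le_mul_of_nonneg_left (hb.sum_Ico_le n m) hc'
  calc ‖∑ i ∈ Finset.Ico n m, b i • (u i - u' i)‖
      = ‖∑ i ∈ Finset.Ico n m, b i • (u i - u (i + 1)) +
          ∑ i ∈ Finset.Ico n m, b i • (u (i + 1) - u' i)‖ := by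
        rw [← Finset.sum_add_distrib]
        congr 1
        refine Finset.sum_congr rfl fun i _ => ?_
        rw [← smul_add]; congr 1; abel
    _ ≤ _ := (norm_add_le _ _).trans (add_le_add h1 h2)

end StepSizes

/-! ### Probability that the accumulated noise is large -/

section Noise

variable {Ω X S : Type*} {m0 : MeasurableSpace Ω} {P : Measure Ω} [IsProbabilityMeasure P]
  {𝒢 : Filtration ℕ m0} [NormedAddCommGroup X] [MeasurableSpace X] [BorelSpace X]
  [NormedAddCommGroup S] [MeasurableSpace S] [BorelSpace S]
  {d : ℕ}

/-- The noise accumulated between the indices `n` and `m` by a recursion with step sizes `b` and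
increments `f(x_i, Z_i) + M_{i+1}` around the averaged field `F`. -/
def noiseSum {V : Type*} [NormedAddCommGroup V] [NormedSpace ℝ V] (f : X → S → V) (F : X → V)
    (b : ℕ → ℝ) (x : ℕ → X) (Z : ℕ → S) (M : ℕ → V) (n m : ℕ) : V :=
  ∑ i ∈ Finset.Ico n m, b i • (f (x i) (Z i) - F (x i) + M (i + 1))

/-- From the index `n₀` on, the accumulated noise `E` is at most `δ` as long as `x` stays in the
ball of radius `R`, and it tends to zero if `x` stays there forever. -/
def NoiseSmall {X V : Type*} [NormedAddCommGroup X] [NormedAddCommGroup V] (R δ : ℝ) (x : ℕ → X)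
    (E : ℕ → ℕ → V) (n₀ : ℕ) : Prop :=
  (∀ n m, n₀ ≤ n → n ≤ m → (∀ i, n₀ ≤ i → i < m → ‖x i‖ ≤ R) → ‖E n m‖ ≤ δ) ∧
  ((∀ i, n₀ ≤ i → ‖x i‖ ≤ R) → ∀ ε : ℝ, 0 < ε → ∀ᶠ n in atTop, ∀ m, n ≤ m → ‖E n m‖ ≤ ε)

/-- The martingale part of the noise, stopped outside of the ball of radius `R` and before `N`. -/
noncomputable def truncatedNoise (Pi : Kernel (X × S) S) (v : X → S → EuclideanSpace ℝ (Fin d)) (b : ℕ → ℝ)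
    (x : ℕ → Ω → X) (Z : ℕ → Ω → S) (M : ℕ → Ω → EuclideanSpace ℝ (Fin d)) (R : ℝ) (N n : ℕ) :
    Ω → EuclideanSpace ℝ (Fin d) :=
  {ω | N ≤ n ∧ ‖x n ω‖ ≤ R}.indicator fun ω =>
    b n • (M (n + 1) ω + (v (x n ω) (Z (n + 1) ω) - ∫ s, v (x n ω) s ∂(Pi (x n ω, Z n ω))))

/-- The truncation event lies in `𝒢 n`, so it preserves centring, and on it the martingale noise and
both Poisson terms are bounded; this gives `c₁ + 2 * c₂`. -/
theorem isBoundedDifference_truncatedNoise {Pi : Kernel (X × S) S} [IsMarkovKernel Pi]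
    {x : ℕ → Ω → X} {Z : ℕ → Ω → S} {M : ℕ → Ω → EuclideanSpace ℝ (Fin d)}
    (hx : ∀ n, Measurable[𝒢 n] (x n)) (hZ : ∀ n, Measurable[𝒢 n] (Z n))
    (hM : ∀ n, Measurable[𝒢 (n + 1)] (M (n + 1)))
    (hmarkov : IsMarkovNoise P (fun n => 𝒢 n) Pi x Z)
    (hmds : ∀ n A, MeasurableSet[𝒢 n] A → ∫ ω in A, M (n + 1) ω ∂P = 0)
    {v : X → S → EuclideanSpace ℝ (Fin d)} (hv : Measurable (Function.uncurry v))
    {b : ℕ → ℝ} (hb : IsStepSize b) {R c₁ c₂ c₃ : ℝ} (hc₁ : 0 ≤ c₁) (hc₂ : 0 ≤ c₂) {N : ℕ}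
    (hM_le : ∀ n, N ≤ n → ∀ᵐ ω ∂P, ‖x n ω‖ ≤ R → ‖M (n + 1) ω‖ ≤ c₁)
    (hv_le : ∀ y s, ‖y‖ ≤ R → ‖s‖ < c₃ → ‖v y s‖ ≤ c₂)
    (hZ_lt : ∀ n, N ≤ n → ∀ᵐ ω ∂P, ‖Z n ω‖ < c₃) :
    IsBoundedDifference P 𝒢 (truncatedNoise Pi v b x Z M R N)
      (fun n => (c₁ + 2 * c₂) * b n) := by
  have hset : ∀ n, MeasurableSet[𝒢 n] {ω | N ≤ n ∧ ‖x n ω‖ ≤ R} := fun n => by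
    by_cases h : N ≤ n
    · simp only [h, true_and]
      exact (measurable_norm.comp (hx n)) measurableSet_Iic
    · simp [h]
  have hPi : StronglyMeasurable fun p : X × S => ∫ s, v p.1 s ∂(Pi p) :=
    StronglyMeasurable.integral_kernel_prod_right' (κ := Pi)
      (f := fun p : (X × S) × S => v p.1.1 p.2)
      (hv.comp ((measurable_fst.comp measurable_fst).prodMk measurable_snd)).stronglyMeasurable
  have hPi' : ∀ n, Measurable[𝒢 n] fun ω => ∫ s, v (x n ω) s ∂(Pi (x n ω, Z n ω)) :=
    fun n => hPi.measurable.comp ((hx n).prodMk (hZ n))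
  have hv' : ∀ n, Measurable[𝒢 (n + 1)] fun ω => v (x n ω) (Z (n + 1) ω) := fun n =>
    hv.comp (((hx n).mono (𝒢.mono n.le_succ) le_rfl).prodMk (hZ (n + 1)))
  have hPi_le : ∀ n, N ≤ n → ∀ᵐ ω ∂P, ‖x n ω‖ ≤ R →
      ‖∫ s, v (x n ω) s ∂(Pi (x n ω, Z n ω))‖ ≤ c₂ := by
    intro n hn
    have hball : MeasurableSet {s : S | ‖s‖ < c₃} := measurable_norm measurableSet_Iio
    filter_upwards [hmarkov.ae_apply_eq_one n hball (hZ_lt (n + 1) (by omega))] with ω hω hR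
    have h1 : ∀ᵐ s ∂(Pi (x n ω, Z n ω)), ‖v (x n ω) s‖ ≤ c₂ := by
      have h2 : ∀ᵐ s ∂(Pi (x n ω, Z n ω)), s ∈ {s : S | ‖s‖ < c₃} :=
        (prob_compl_eq_zero_iff hball).2 hω
      filter_upwards [h2] with s hs
      exact hv_le _ _ hR hs
    simpa using norm_integral_le_of_norm_le_const h1
  refine ⟨fun n => ?_, fun n => ?_, fun n A hA => ?_⟩
  · exact (((hM n).add ((hv' n).sub ((hPi' n).mono (𝒢.mono n.le_succ) le_rfl))).const_smul
      (b n)).indicator (𝒢.mono n.le_succ _ (hset n))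
  · have hnn : 0 ≤ (c₁ + 2 * c₂) * b n := mul_nonneg (by linarith) (hb.nonneg n)
    by_cases hn : N ≤ n
    · filter_upwards [hM_le n hn, hPi_le n hn, hZ_lt (n + 1) (by omega)] with ω h1 h2 h3
      by_cases hω : ‖x n ω‖ ≤ R
      · rw [truncatedNoise, Set.indicator_of_mem (show ω ∈ {ω | N ≤ n ∧ ‖x n ω‖ ≤ R} from ⟨hn, hω⟩),
          norm_smul, Real.norm_of_nonneg (hb.nonneg n), mul_comm]
        refine mul_le_mul_of_nonneg_right ?_ (hb.nonneg n)
        have h4 := norm_add_le (M (n + 1) ω)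
          (v (x n ω) (Z (n + 1) ω) - ∫ s, v (x n ω) s ∂(Pi (x n ω, Z n ω)))
        have h5 := norm_sub_le (v (x n ω) (Z (n + 1) ω)) (∫ s, v (x n ω) s ∂(Pi (x n ω, Z n ω)))
        linarith [h1 hω, h2 hω, hv_le _ _ hω h3]
      · rw [truncatedNoise, Set.indicator_of_notMem (fun h => hω h.2), norm_zero]
        exact hnn
    · refine Eventually.of_forall fun ω => ?_
      rw [truncatedNoise, Set.indicator_of_notMem (fun h => hn h.1), norm_zero]
      exact hnn
  · rw [truncatedNoise, setIntegral_indicator (𝒢.le n _ (hset n))]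
    by_cases hn : N ≤ n
    · set A' := A ∩ {ω | N ≤ n ∧ ‖x n ω‖ ≤ R} with hA'def
      have hAm : MeasurableSet[𝒢 n] A' := hA.inter (hset n)
      have hAm' := 𝒢.le n _ hAm
      have i1 : IntegrableOn (M (n + 1)) A' P := by
        refine Measure.integrableOn_of_bounded (M := c₁) (measure_ne_top _ _)
          ((hM n).mono (𝒢.le _) le_rfl).aestronglyMeasurable ?_
        rw [ae_restrict_iff' hAm']
        filter_upwards [hM_le n hn] with ω h1 h2
        exact h1 h2.2.2
      have hvA : ∀ᵐ ω ∂P, ω ∈ A' → ‖v (x n ω) (Z (n + 1) ω)‖ ≤ c₂ := by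
        filter_upwards [hZ_lt (n + 1) (by omega)] with ω h1 h2
        exact hv_le _ _ h2.2.2 h1
      have i2 : IntegrableOn (fun ω => v (x n ω) (Z (n + 1) ω)) A' P := by
        refine Measure.integrableOn_of_bounded (M := c₂) (measure_ne_top _ _)
          ((hv' n).mono (𝒢.le _) le_rfl).aestronglyMeasurable ?_
        rwa [ae_restrict_iff' hAm']
      have i3 : IntegrableOn (fun ω => ∫ s, v (x n ω) s ∂(Pi (x n ω, Z n ω))) A' P := by
        refine Measure.integrableOn_of_bounded (M := c₂) (measure_ne_top _ _)
          ((hPi' n).mono (𝒢.le _) le_rfl).aestronglyMeasurable ?_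
        rw [ae_restrict_iff' hAm']
        filter_upwards [hPi_le n hn] with ω h1 h2
        exact h1 h2.2.2
      rw [integral_smul, integral_add i1 (by exact i2.sub i3), integral_sub i2 i3, hmds n _ hAm,
        hmarkov.setIntegral_eq hx hZ n hAm hv hvA, sub_self, add_zero, smul_zero]
    · simp [hn]

/-- While `x` is in the ball, the noise is a sum of the stopped martingale differences plus a
deterministic remainder `rem n → 0`. The maximal inequality controls the first clause of
`NoiseSmall`; the second holds almost surely by martingale convergence. -/
theorem exists_measure_inter_not_noiseSmall_le [SecondCountableTopology X] {Pi : Kernel (X × S) S} [IsMarkovKernel Pi]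
    {Γ : X → Measure S} {f : X → S → EuclideanSpace ℝ (Fin d)}
    {x : ℕ → Ω → X} {Z : ℕ → Ω → S} {M : ℕ → Ω → EuclideanSpace ℝ (Fin d)}
    (hx : ∀ n, Measurable[𝒢 n] (x n)) (hZ : ∀ n, Measurable[𝒢 n] (Z n))
    (hM : ∀ n, Measurable[𝒢 (n + 1)] (M (n + 1)))
    (hmarkov : IsMarkovNoise P (fun n => 𝒢 n) Pi x Z) (hbdd : EventuallyBounded P Z)
    (hpoisson : PoissonRegular Pi Γ f)
    (hmds : ∀ n A, MeasurableSet[𝒢 n] A → ∫ ω in A, M (n + 1) ω ∂P = 0)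
    {b : ℕ → ℝ} (hb : IsStepSize b) {R C : ℝ} (hR : 0 < R) (hC : 0 ≤ C)
    (hinc : ∀ᶠ n in atTop, ∀ᵐ ω ∂P, ‖x n ω‖ ≤ R →
      ‖x (n + 1) ω - x n ω‖ ≤ C * b n ∧ ‖M (n + 1) ω‖ ≤ C)
    {δ : ℝ} (hδ : 0 < δ) :
    ∃ K : ℝ, 0 ≤ K ∧ ∀ᶠ n₀ in atTop, ∀ B, MeasurableSet[𝒢 n₀] B →
      P (B ∩ {ω | ¬ NoiseSmall R δ (fun n => x n ω) (noiseSum f (meanField Γ f) b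
        (fun n => x n ω) (fun n => Z n ω) (fun n => M n ω)) n₀}) ≤
      ENNReal.ofReal (K * tailSq b n₀ ^ 2) * P B := by
  obtain ⟨v, hvm, -, hveq, hvreg⟩ := hpoisson
  obtain ⟨c₃, hc₃, hZb⟩ := hbdd
  have hv : Measurable (Function.uncurry v) := measurable_uncurry_of_locally_lipschitz hvm
    fun R hR => by
      obtain ⟨C, -, -, h⟩ := hvreg R hR
      exact ⟨C, h⟩
  -- The last iterate may lie one step outside the ball, and `v` must be controlled there too.
  set R' : ℝ := R + C * b 0 with hR'
  have hRR' : R ≤ R' := by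
    have := mul_nonneg hC (hb.nonneg 0)
    linarith
  obtain ⟨C', hC', hvgrow, hvlip⟩ := hvreg R' (hR.trans_le hRR')
  obtain ⟨N, hN⟩ := eventually_atTop.1 (hinc.and hZb)
  set c₂ : ℝ := C' * (1 + c₃) with hc₂
  have hc₂0 : 0 ≤ c₂ := by positivity
  have hv_le : ∀ y s, ‖y‖ ≤ R' → ‖s‖ < c₃ → ‖v y s‖ ≤ c₂ := fun y s hy hs =>
    (hvgrow y s hy).trans (by rw [hc₂]; gcongr)
  set D := truncatedNoise Pi v b x Z M R N with hDdef
  have hD : IsBoundedDifference P 𝒢 D (fun n => (C + 2 * c₂) * b n) :=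
    isBoundedDifference_truncatedNoise hx hZ hM hmarkov hmds hv hb hC hc₂0
      (fun n hn => (hN n hn).1.mono fun ω h h' => (h h').2)
      (fun y s hy hs => hv_le y s (hy.trans hRR') hs) (fun n hn => (hN n hn).2)
  have hσ : ∀ n₀ n, ∑ i ∈ Finset.range n, ((C + 2 * c₂) * b (n₀ + i)) ^ 2 ≤
      (C + 2 * c₂) ^ 2 * tailSq b n₀ := fun n₀ n => by
    simp only [mul_pow]
    rw [← Finset.mul_sum]
    exact mul_le_mul_of_nonneg_left (hb.sum_range_le n₀ n) (sq_nonneg _)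
  have hconv := hD.ae_exists_tendsto_partialSum (by simpa using hσ 0)
  set rem : ℕ → ℝ := fun n => 2 * c₂ * b n + c₂ * C * tailSq b n with hrem
  have hrem0 : Tendsto rem atTop (𝓝 0) := by
    simpa using (hb.tendsto_zero.const_mul (2 * c₂)).add ((tendsto_tailSq b).const_mul (c₂ * C))
  have hpath : ∀ᵐ ω ∂P, ∀ n, N ≤ n → (‖x n ω‖ ≤ R → ‖x (n + 1) ω - x n ω‖ ≤ C * b n) ∧
      ‖Z n ω‖ < c₃ := by
    refine ae_all_iff.2 fun n => ?_
    by_cases hn : N ≤ n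
    · filter_upwards [(hN n hn).1, (hN n hn).2] with ω h1 h2 _
      exact ⟨fun h => (h1 h).1, h2⟩
    · exact Eventually.of_forall fun ω h => absurd h hn
  -- Before the exit from the ball the truncation is invisible, and the Poisson equation rewrites
  -- each increment as `D i` plus a nearly telescoping term.
  have hdecomp : ∀ᵐ ω ∂P, ∀ n m, N ≤ n → n ≤ m → (∀ i, n ≤ i → i < m → ‖x i ω‖ ≤ R) →
      ‖noiseSum f (meanField Γ f) b (fun n => x n ω) (fun n => Z n ω) (fun n => M n ω) n m‖ ≤
        ‖∑ i ∈ Finset.Ico n m, D i ω‖ + rem n := by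
    filter_upwards [hpath] with ω hω n m hNn hnm hin
    rcases hnm.eq_or_lt with rfl | hlt
    · have h1 : 0 ≤ rem n := by
        have := hb.nonneg n
        have := (hb.tailSq_pos n).le
        positivity
      simpa [noiseSum] using h1
    have hle : ∀ i, n ≤ i → i ≤ m → ‖x i ω‖ ≤ R' := by
      intro i hni him
      rcases him.lt_or_eq with h | h
      · exact (hin i hni h).trans hRR'
      · obtain ⟨j, rfl⟩ : ∃ j, i = j + 1 := ⟨i - 1, by omega⟩
        have hj := hin j (by omega) (by omega)
        have h1 := (hω j (by omega)).1 hj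
        have h2 := norm_le_norm_sub_add (x (j + 1) ω) (x j ω)
        have h3 : C * b j ≤ C * b 0 := mul_le_mul_of_nonneg_left (hb.2.1 (Nat.zero_le j)) hC
        linarith
    have hsplit : noiseSum f (meanField Γ f) b (fun n => x n ω) (fun n => Z n ω)
        (fun n => M n ω) n m = ∑ i ∈ Finset.Ico n m, D i ω +
          ∑ i ∈ Finset.Ico n m, b i • (v (x i ω) (Z i ω) - v (x i ω) (Z (i + 1) ω)) := by
      rw [noiseSum, ← Finset.sum_add_distrib]
      refine Finset.sum_congr rfl fun i hi => ?_
      rw [Finset.mem_Ico] at hi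
      rw [hDdef, truncatedNoise, Set.indicator_of_mem
        (show ω ∈ {ω | N ≤ i ∧ ‖x i ω‖ ≤ R} from ⟨by omega, hin i hi.1 hi.2⟩), ← smul_add,
        ← hveq (x i ω) (Z i ω)]
      congr 1
      abel
    rw [hsplit]
    refine (norm_add_le _ _).trans (add_le_add le_rfl ?_)
    refine norm_sum_smul_sub_le hb (u := fun i => v (x i ω) (Z i ω))
      (u' := fun i => v (x i ω) (Z (i + 1) ω)) (by positivity)
      (fun i h1 h2 => hv_le _ _ (hle i h1 h2) (hω i (by omega)).2) (fun i h1 h2 => ?_) hnm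
    have h3 := (hω i (by omega)).1 (hin i h1 h2)
    calc _ ≤ C' * ‖x (i + 1) ω - x i ω‖ * (1 + ‖Z (i + 1) ω‖) :=
          hvlip _ _ _ (hle (i + 1) (by omega) h2) (hle i h1 h2.le)
      _ ≤ C' * (C * b i) * (1 + c₃) := by
          have := (hω (i + 1) (by omega)).2
          have := hb.nonneg i
          gcongr
      _ = _ := by rw [hc₂]; ring
  refine ⟨d * (4 / (δ / 4 / (d + 1)) ^ 4) * (C + 2 * c₂) ^ 4, by positivity, ?_⟩
  have hsmall : ∀ᶠ n₀ in atTop, ∀ n, n₀ ≤ n → rem n ≤ δ / 2 :=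
    eventually_forall_ge_atTop.2 (hrem0.eventually_le_const (half_pos hδ))
  filter_upwards [hsmall, eventually_ge_atTop N] with n₀ hn₀ hN₀ B hB
  -- The sum from `n` to `m` is a difference of two sums from `n₀`, each below `δ / 4`; the other `δ
  -- / 2` is left for the remainder.
  have hbad := hD.measure_inter_exists_le_norm_sum_Ico (δ := δ / 4) (by positivity) (hσ n₀) hB
  have hK : (d : ℝ) * (4 / (δ / 4 / (d + 1)) ^ 4) * ((C + 2 * c₂) ^ 2 * tailSq b n₀) ^ 2 =
      d * (4 / (δ / 4 / (d + 1)) ^ 4) * (C + 2 * c₂) ^ 4 * tailSq b n₀ ^ 2 := by ring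
  rw [hK] at hbad
  refine le_trans (measure_mono_ae ?_) hbad
  filter_upwards [hdecomp, hconv] with ω h1 h2
  rintro ⟨hωB, hω⟩
  refine ⟨hωB, ?_⟩
  by_contra hcon
  simp only [Set.mem_ofPred_eq, not_exists, not_le] at hcon
  have hIco : ∀ {k n m : ℕ}, k ≤ n → n ≤ m → ∑ i ∈ Finset.Ico n m, D i ω =
      ∑ i ∈ Finset.Ico k m, D i ω - ∑ i ∈ Finset.Ico k n, D i ω := fun hkn hnm => by
    rw [← Finset.sum_Ico_consecutive _ hkn hnm, add_sub_cancel_left]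
  refine hω ⟨fun n m hn hnm hin => ?_, fun hin ε hε => ?_⟩
  · refine (h1 n m (hN₀.trans hn) hnm fun i hi => hin i (hn.trans hi)).trans ?_
    have h3 := norm_sub_le (∑ i ∈ Finset.Ico n₀ m, D i ω) (∑ i ∈ Finset.Ico n₀ n, D i ω)
    rw [← hIco hn hnm] at h3
    linarith [hcon n, hcon m, hn₀ n hn]
  · obtain ⟨l, hl⟩ := h2
    obtain ⟨n₁, hn₁⟩ := Metric.cauchySeq_iff.1 hl.cauchySeq (ε / 2) (half_pos hε)
    filter_upwards [eventually_ge_atTop n₁, eventually_ge_atTop n₀,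
      hrem0.eventually_le_const (half_pos hε)] with n h3 h4 h5 m hnm
    refine (h1 n m (hN₀.trans h4) hnm fun i hi _ => hin i (h4.trans hi)).trans ?_
    have h6 := hn₁ m (h3.trans hnm) n h3
    rw [dist_eq_norm, partialSum, partialSum, ← Finset.sum_Ico_eq_sub _ hnm] at h6
    linarith

end Noise

/-! ### Lock-in -/

section Convergence

open NNReal

variable {X : Type*} [NormedAddCommGroup X] [NormedSpace ℝ X] {F : X → X} {L : ℝ≥0}

/-- Lock-in: if the defects of an Euler scheme are small as long as the scheme is bounded, then a
scheme that starts in a compact part of the domain of attraction of a Lyapunov stable set stays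
bounded and converges to that set. -/
theorem exists_forall_norm_le_and_tendsto_infDist (hF : LipschitzWith L F) {A U D : Set X}
    (hU : IsCompact U) (hUA : U ⊆ domainOfAttraction F A) (hA : LyapunovStable F A) {r : ℝ}
    (hr : 0 < r) (hD : ∀ p ∈ D, Metric.infDist p A < r → p ∈ U) :
    ∃ R T δ : ℝ, 0 < R ∧ 0 < T ∧ 0 < δ ∧ ∀ (x : ℕ → X) (b : ℕ → ℝ) (n₀ : ℕ), IsStepSize b →
      (∀ i, n₀ ≤ i → b i ≤ δ) → x n₀ ∈ U → (∀ n, n₀ ≤ n → x n ∈ D) →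
      (∀ n m, n₀ ≤ n → n ≤ m → (∀ i, n₀ ≤ i → i < m → ‖x i‖ ≤ R) →
        ∑ i ∈ Finset.Ico n m, b i ≤ T → ‖eulerDefect F b x n m‖ ≤ δ) →
      ((∀ i, n₀ ≤ i → ‖x i‖ ≤ R) → ∀ T' ε : ℝ, 0 < ε → ∀ᶠ n in atTop, ∀ m, n ≤ m →
        ∑ i ∈ Finset.Ico n m, b i ≤ T' → ‖eulerDefect F b x n m‖ ≤ ε) →
      (∀ n, n₀ ≤ n → ‖x n‖ ≤ R) ∧ Tendsto (fun n => Metric.infDist (x n) A) atTop (𝓝 0) := by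
  obtain ⟨R, T, δ, hT, hδ, H⟩ := exists_norm_le_of_eulerDefect hF hU hUA hA hr hD
  refine ⟨max R 1, T, δ, by positivity, hT, hδ, fun x b n₀ hb hbδ hx₀ hxD h1 h2 => ?_⟩
  -- The defect up to `n` is controlled as soon as the indices strictly below `n` are in the ball,
  -- so boundedness bootstraps by strong induction.
  have key : ∀ n, n₀ ≤ n →
      ‖x n‖ ≤ max R 1 ∧ (T ≤ ∑ i ∈ Finset.Ico n₀ n, b i → x n ∈ U) := by
    intro n
    induction n using Nat.strong_induction_on with
    | _ n ih =>
      intro hn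
      have h3 := H x b n₀ n hb.nonneg hbδ hx₀ (fun i hi _ => hxD i hi)
        (fun i j hi hij hj hT => h1 i j hi hij
          (fun l hl hlj => (ih l (by omega) hl).1) hT) n hn le_rfl
      exact ⟨h3.1.trans (le_max_left _ _), h3.2⟩
  have hbd : ∀ n, n₀ ≤ n → ‖x n‖ ≤ max R 1 := fun n hn => (key n hn).1
  refine ⟨hbd, tendsto_infDist_of_eulerDefect hF hU hUA hA hb.nonneg hb.tendsto_zero hb.2.2.1 ?_
    (h2 hbd)⟩
  filter_upwards [(tendsto_sum_Ico_atTop hb.nonneg hb.2.2.1 n₀).eventually_ge_atTop T, eventually_ge_atTop n₀]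
    with n h3 h4
  exact (key n h4).2 h3

end Convergence

/-! ### The graph of the equilibrium map -/

section Graph

open NNReal

variable {X Y : Type*} [NormedAddCommGroup X] [NormedAddCommGroup Y] {L : ℝ≥0}

/-- Choose the graph point over `C` nearest to `p` and the point of `H` nearest to `p.1`; their base
points are close, so `lam` takes close values there. -/
theorem infDist_graph_le {lam : X → Y} (hlam : LipschitzWith L lam) {C H : Set X}
    (hC : IsCompact C) (hC0 : C.Nonempty) (hH : IsCompact H) (hH0 : H.Nonempty) (p : X × Y) :
    Metric.infDist p ((fun x => (x, lam x)) '' H) ≤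
      (1 + L) * (Metric.infDist p ((fun x => (x, lam x)) '' C) + Metric.infDist p.1 H) := by
  obtain ⟨_, ⟨c, hc, rfl⟩, h1⟩ := (hC.image
    (continuous_id.prodMk hlam.continuous)).exists_infDist_eq_dist (hC0.image _) p
  obtain ⟨q, hq, h2⟩ := hH.exists_infDist_eq_dist hH0 p.1
  have h3 : Metric.infDist p ((fun x => (x, lam x)) '' H) ≤ dist p (q, lam q) :=
    Metric.infDist_le_dist_of_mem ⟨q, hq, rfl⟩
  simp only [id] at h1
  rw [h1, h2]
  refine h3.trans ?_
  have h4 := hlam.dist_le_mul c q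
  have h5 : dist p.1 c ≤ dist p (c, lam c) := by rw [Prod.dist_eq]; exact le_max_left _ _
  have h6 : dist p.2 (lam c) ≤ dist p (c, lam c) := by rw [Prod.dist_eq]; exact le_max_right _ _
  have h7 := dist_triangle_left c q p.1
  have h8 := dist_triangle p.2 (lam c) (lam q)
  have h9 : (L : ℝ) * dist c q ≤ L * (dist p (c, lam c) + dist p.1 q) := by
    gcongr
    linarith
  have h10 : 0 ≤ (L : ℝ) * (dist p (c, lam c) + dist p.1 q) := by positivity
  have h11 : 0 ≤ dist p (c, lam c) := dist_nonneg
  have h12 : 0 ≤ dist p.1 q := dist_nonneg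
  rw [Prod.dist_eq (x := p) (y := (q, lam q))]
  refine max_le ?_ ?_ <;> simp only <;> linarith

/-- The graph of the equilibrium map attracts the points above its base for the system with a
frozen slow variable. -/
theorem prod_subset_domainOfAttraction [NormedSpace ℝ X] [NormedSpace ℝ Y] [CompleteSpace Y]
    {G : X × Y → Y} (hG : LipschitzWith L G)
    {lam : X → Y} (hattr : ∀ x, IsGlobalAttractor (fun y => G (x, y)) (lam x)) (C : Set X)
    (V : Set Y) :
    C ×ˢ V ⊆ domainOfAttraction (fun p : X × Y => ((0 : X), G p)) ((fun x => (x, lam x)) '' C) := by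
  rintro ⟨x, y₀⟩ ⟨hx, -⟩
  obtain ⟨y, hy, hy0⟩ := exists_isSolution
    (F := fun y => G (x, y)) (hG.comp (LipschitzWith.prodMk_left x)) y₀
  refine ⟨fun t => (x, y t), fun t ht => (hasDerivWithinAt_const t _ x).prodMk (hy t ht),
    by simp [hy0], ?_⟩
  have h1 := (hattr x).2 y hy
  rw [tendsto_iff_dist_tendsto_zero] at h1
  refine squeeze_zero (fun t => Metric.infDist_nonneg) (fun t => ?_) h1
  refine (Metric.infDist_le_dist_of_mem (Set.mem_image_of_mem _ hx)).trans ?_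
  simp [Prod.dist_eq]

end Graph

/-! ### Generated filtrations -/

section Histories

variable {Ω S : Type*} [MeasurableSpace S] {X : ℕ → Ω → S}

theorem hist_mono (X : ℕ → Ω → S) : Monotone (hist X) := fun _ _ hij =>
  iSup₂_le fun m hm => le_iSup₂ (f := fun m _ => MeasurableSpace.comap (X m) inferInstance) m
    (hm.trans hij)

theorem hist_le [m0 : MeasurableSpace Ω] (hX : ∀ n, Measurable (X n)) (n : ℕ) : hist X n ≤ m0 :=
  iSup₂_le fun m _ => (hX m).comap_le

theorem measurable_hist (X : ℕ → Ω → S) (n : ℕ) : Measurable[hist X n] (X n) :=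
  measurable_iff_comap_le.2
    (le_iSup₂ (f := fun m _ => MeasurableSpace.comap (X m) inferInstance) n le_rfl)

theorem IsMartingaleDifference.setIntegral_eq_zero {V : Type*} [NormedAddCommGroup V]
    [NormedSpace ℝ V] [CompleteSpace V] {m0 : MeasurableSpace Ω} {P : Measure Ω}
    [IsProbabilityMeasure P] {ℱ : ℕ → MeasurableSpace Ω} {M : ℕ → Ω → V}
    (h : IsMartingaleDifference P ℱ M) {n : ℕ} (hle : ℱ n ≤ m0) {A : Set Ω}
    (hA : MeasurableSet[ℱ n] A) : ∫ ω in A, M (n + 1) ω ∂P = 0 := by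
  rw [← setIntegral_condExp hle (h n).1 hA]
  exact integral_eq_zero_of_ae (ae_restrict_of_ae (h n).2)

end Histories

/-! ### Conditional union bound and order of the errors -/

section Conditioning

theorem le_measureReal_cond {Ω : Type*} {m0 : MeasurableSpace Ω} {P : Measure Ω}
    [IsProbabilityMeasure P] {B E N₁ N₂ : Set Ω} (hB : MeasurableSet B) (hB0 : P B ≠ 0)
    {e₁ e₂ : ℝ} (he₁ : 0 ≤ e₁) (he₂ : 0 ≤ e₂) (h₁ : P (B ∩ N₁) ≤ ENNReal.ofReal e₁ * P B)
    (h₂ : P (B ∩ N₂) ≤ ENNReal.ofReal e₂ * P B)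
    (hE : ∀ᵐ ω ∂P, ω ∈ B → ω ∉ N₁ → ω ∉ N₂ → ω ∈ E) : 1 - e₁ - e₂ ≤ (P[|B]).real E := by
  have h3 : P B ≤ P (B ∩ E) + (P (B ∩ N₁) + P (B ∩ N₂)) := by
    refine le_trans (measure_mono_ae ?_) ((measure_union_le _ _).trans
      (add_le_add le_rfl (measure_union_le _ _)))
    filter_upwards [hE] with ω hω hωB
    by_cases hN₁ : ω ∈ N₁
    · exact Or.inr (Or.inl ⟨hωB, hN₁⟩)
    · by_cases hN₂ : ω ∈ N₂
      · exact Or.inr (Or.inr ⟨hωB, hN₂⟩)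
      · exact Or.inl ⟨hωB, hω hωB hN₁ hN₂⟩
  have h4 : P B ≤ P (B ∩ E) + ENNReal.ofReal (e₁ + e₂) * P B := by
    rw [ENNReal.ofReal_add he₁ he₂, add_mul]
    exact h3.trans (add_le_add le_rfl (add_le_add h₁ h₂))
  have h5 : P.real B ≤ P.real (B ∩ E) + (e₁ + e₂) * P.real B := by
    have := ENNReal.toReal_mono (by finiteness) h4
    rwa [ENNReal.toReal_add (by finiteness) (by finiteness), ENNReal.toReal_mul,
      ENNReal.toReal_ofReal (by positivity)] at this
  have hpos : 0 < P.real B := ENNReal.toReal_pos hB0 (measure_ne_top _ _)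
  rw [measureReal_def, cond_apply hB, ENNReal.toReal_mul, ENNReal.toReal_inv,
    ← measureReal_def, ← measureReal_def, inv_mul_eq_div, le_div_iff₀ hpos]
  linarith

theorem isLittleO_const_mul_tailSq_sq (K : ℝ) (a : ℕ → ℝ) :
    (fun n => K * tailSq a n ^ 2) =o[atTop] tailSq a := by
  have h1 : Tendsto (fun n => K * tailSq a n) atTop (𝓝 0) := by
    simpa using (tendsto_tailSq a).const_mul K
  have h2 := ((isLittleO_one_iff ℝ).2 h1).mul_isBigO (isBigO_refl (tailSq a) atTop)
  simpa [sq, mul_assoc] using h2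

end Conditioning

/-! ### Slow lock-in and fast tracking -/

section TwoTimescales

open NNReal

theorem sub_eq_sum_Ico {V : Type*} [AddCommGroup V] {y u : ℕ → V}
    (h : ∀ n, y (n + 1) = y n + u n) {n m : ℕ} (hnm : n ≤ m) :
    y m - y n = ∑ i ∈ Finset.Ico n m, u i := by
  induction m, hnm using Nat.le_induction with
  | base => simp
  | succ m hnm ih => rw [Finset.sum_Ico_succ_top hnm, ← ih, h]; abel

theorem sub_sub_sum_eq_noiseSum {X S V : Type*} [NormedAddCommGroup V] [NormedSpace ℝ V]
    {f : X → S → V} (F : X → V) {b : ℕ → ℝ} {x : ℕ → X} {Z : ℕ → S} {M y : ℕ → V}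
    (h : ∀ n, y (n + 1) = y n + b n • (f (x n) (Z n) + M (n + 1))) {n m : ℕ} (hnm : n ≤ m) :
    y m - y n - ∑ i ∈ Finset.Ico n m, b i • F (x i) = noiseSum f F b x Z M n m := by
  rw [sub_eq_sum_Ico h hnm, noiseSum, ← Finset.sum_sub_distrib]
  refine Finset.sum_congr rfl fun i _ => ?_
  rw [← smul_sub]
  congr 1
  abel

variable {Ω : Type*} {m0 : MeasurableSpace Ω} {P : Measure Ω} [IsProbabilityMeasure P]
  {𝒢 : Filtration ℕ m0} {d k l m : ℕ}

/-- Up to an event whose conditional probability given the past is `O((∑_{i ≥ n} a(i)²)²)`, the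
recursion that starts in a compact part of the domain of attraction of an asymptotically stable
set stays bounded and converges to that set. -/
theorem exists_lockIn
    {θ : ℕ → Ω → EuclideanSpace ℝ (Fin d)} {Z : ℕ → Ω → EuclideanSpace ℝ (Fin l)}
    {M : ℕ → Ω → EuclideanSpace ℝ (Fin d)}
    (hθ : ∀ n, Measurable[𝒢 n] (θ n)) (hZ : ∀ n, Measurable[𝒢 n] (Z n))
    (hM : ∀ n, Measurable[𝒢 (n + 1)] (M (n + 1)))
    {h : EuclideanSpace ℝ (Fin d) → EuclideanSpace ℝ (Fin l) → EuclideanSpace ℝ (Fin d)}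
    {a : ℕ → ℝ} (ha : IsStepSize a)
    (hrec : ∀ n ω, θ (n + 1) ω = θ n ω + a n • (h (θ n ω) (Z n ω) + M (n + 1) ω))
    {Pi : Kernel (EuclideanSpace ℝ (Fin d) × EuclideanSpace ℝ (Fin l))
      (EuclideanSpace ℝ (Fin l))} [IsMarkovKernel Pi]
    {Γ : EuclideanSpace ℝ (Fin d) → Measure (EuclideanSpace ℝ (Fin l))}
    (hmarkov : IsMarkovNoise P (fun n => 𝒢 n) Pi θ Z) (hbdd : EventuallyBounded P Z)
    (hgrowth : ∃ K : ℝ, ∀ x z, ‖h x z‖ ≤ K * (1 + ‖x‖))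
    (hlip : ∃ L, LipschitzWith L (meanField Γ h)) (hpoisson : PoissonRegular Pi Γ h)
    (hmds : ∀ n A, MeasurableSet[𝒢 n] A → ∫ ω in A, M (n + 1) ω ∂P = 0)
    (hM_bound : ∃ K' : ℝ, ∀ n, ∀ᵐ ω ∂P, ‖M (n + 1) ω‖ ≤ K' * (1 + ‖θ n ω‖))
    {H B : Set (EuclideanSpace ℝ (Fin d))} (hH : AsymptoticallyStable (meanField Γ h) H)
    (hB : IsOpen B) (hBc : IsCompact (closure B)) (hHB : H ⊆ B)
    (hBG : closure B ⊆ domainOfAttraction (meanField Γ h) H) :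
    ∃ R K : ℝ, 0 < R ∧ 0 ≤ K ∧ ∃ N : ℕ → Set Ω, ∀ᶠ n₀ in atTop,
      (∀ A, MeasurableSet[𝒢 n₀] A → P (A ∩ N n₀) ≤ ENNReal.ofReal (K * tailSq a n₀ ^ 2) * P A) ∧
      ∀ ω, θ n₀ ω ∈ B → ω ∉ N n₀ → (∀ n, n₀ ≤ n → ‖θ n ω‖ ≤ R) ∧
        Tendsto (fun n => Metric.infDist (θ n ω) H) atTop (𝓝 0) := by
  obtain ⟨K₁, hK₁⟩ := hgrowth
  obtain ⟨K₂, hK₂⟩ := hM_bound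
  obtain ⟨L, hL⟩ := hlip
  obtain ⟨hHc, hH0, hHs, -⟩ := hH
  obtain ⟨r, hr, hrB⟩ := hHc.exists_thickening_subset_open hB hHB
  obtain ⟨R, T, δ, hR, -, hδ, hlock⟩ := exists_forall_norm_le_and_tendsto_infDist hL hBc hBG hHs hr
    (D := Set.univ) fun p _ hp =>
      subset_closure (hrB ((Metric.mem_thickening_iff_infDist_lt hH0).2 hp))
  set C : ℝ := |K₁| * (1 + R) + |K₂| * (1 + R) with hC
  have hinc : ∀ n, ∀ᵐ ω ∂P, ‖θ n ω‖ ≤ R →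
      ‖θ (n + 1) ω - θ n ω‖ ≤ C * a n ∧ ‖M (n + 1) ω‖ ≤ C := by
    intro n
    filter_upwards [hK₂ n] with ω hω hωR
    have h1 : ‖h (θ n ω) (Z n ω)‖ ≤ |K₁| * (1 + R) :=
      (hK₁ _ _).trans (by gcongr; exact le_abs_self _)
    have h2 : ‖M (n + 1) ω‖ ≤ |K₂| * (1 + R) :=
      hω.trans (by gcongr; exact le_abs_self _)
    have h3 : 0 ≤ |K₁| * (1 + R) := by positivity
    refine ⟨?_, by linarith⟩
    rw [hrec, add_sub_cancel_left, norm_smul, Real.norm_of_nonneg (ha.nonneg n), mul_comm]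
    exact mul_le_mul_of_nonneg_right ((norm_add_le _ _).trans (add_le_add h1 h2)) (ha.nonneg n)
  obtain ⟨K, hK, hnoise⟩ := exists_measure_inter_not_noiseSmall_le hθ hZ hM hmarkov hbdd hpoisson
    hmds ha hR (by positivity) (Eventually.of_forall hinc) hδ
  refine ⟨R, K, hR, hK, fun n₀ => {ω | ¬ NoiseSmall R δ (fun n => θ n ω)
    (noiseSum h (meanField Γ h) a (fun n => θ n ω) (fun n => Z n ω) (fun n => M n ω)) n₀}, ?_⟩
  have hsmall : ∀ᶠ n₀ in atTop, ∀ i, n₀ ≤ i → a i ≤ δ :=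
    eventually_forall_ge_atTop.2 (ha.tendsto_zero.eventually_le_const hδ)
  filter_upwards [hnoise, hsmall] with n₀ h1 h2
  refine ⟨h1, fun ω hωB hω => ?_⟩
  simp only [not_not] at hω
  have hdef : ∀ n m, n ≤ m → eulerDefect (meanField Γ h) a (fun n => θ n ω) n m =
      noiseSum h (meanField Γ h) a (fun n => θ n ω) (fun n => Z n ω) (fun n => M n ω) n m :=
    fun n m hnm => sub_sub_sum_eq_noiseSum (y := fun n => θ n ω) _ (fun n => hrec n ω) hnm
  refine hlock (fun n => θ n ω) a n₀ ha h2 (subset_closure hωB) (fun _ _ => trivial)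
    (fun n m hn hnm hin _ => ?_) (fun hin T' ε hε => ?_)
  · rw [hdef n m hnm]
    exact hω.1 n m hn hnm hin
  · filter_upwards [hω.2 hin ε hε] with n hn m hnm _
    rw [hdef n m hnm]
    exact hn m hnm

/-- As long as the slow iterates stay in a ball and up to an event whose conditional probability
given the past is `O((∑_{i ≥ n} b(i)²)²)`, the fast iterates that start in a bounded set track the
equilibrium map. -/
theorem exists_tracking
    {θ : ℕ → Ω → EuclideanSpace ℝ (Fin d)} {w : ℕ → Ω → EuclideanSpace ℝ (Fin k)}
    {Z₁ : ℕ → Ω → EuclideanSpace ℝ (Fin l)} {Z : ℕ → Ω → EuclideanSpace ℝ (Fin m)}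
    {M₁ : ℕ → Ω → EuclideanSpace ℝ (Fin d)} {M : ℕ → Ω → EuclideanSpace ℝ (Fin k)}
    (hθ : ∀ n, Measurable[𝒢 n] (θ n)) (hw : ∀ n, Measurable[𝒢 n] (w n))
    (hZ : ∀ n, Measurable[𝒢 n] (Z n)) (hM : ∀ n, Measurable[𝒢 (n + 1)] (M (n + 1)))
    {h : EuclideanSpace ℝ (Fin d) → EuclideanSpace ℝ (Fin l) → EuclideanSpace ℝ (Fin d)}
    {g : EuclideanSpace ℝ (Fin d) × EuclideanSpace ℝ (Fin k) → EuclideanSpace ℝ (Fin m) →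
      EuclideanSpace ℝ (Fin k)}
    {a b : ℕ → ℝ} (ha : IsStepSize a) (hb : IsStepSize b) (hab : ∀ n, a n < b n)
    (hab0 : Tendsto (fun n => a n / b n) atTop (𝓝 0))
    (hrecθ : ∀ n ω, θ (n + 1) ω = θ n ω + a n • (h (θ n ω) (Z₁ n ω) + M₁ (n + 1) ω))
    (hrecw : ∀ n ω, w (n + 1) ω = w n ω + b n • (g (θ n ω, w n ω) (Z n ω) + M (n + 1) ω))
    (hgrowth_h : ∃ K : ℝ, ∀ x z, ‖h x z‖ ≤ K * (1 + ‖x‖))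
    (hM₁_bound : ∃ K' : ℝ, ∀ n, ∀ᵐ ω ∂P, ‖M₁ (n + 1) ω‖ ≤ K' * (1 + ‖θ n ω‖))
    {Pi : Kernel ((EuclideanSpace ℝ (Fin d) × EuclideanSpace ℝ (Fin k)) ×
      EuclideanSpace ℝ (Fin m)) (EuclideanSpace ℝ (Fin m))} [IsMarkovKernel Pi]
    {Γ : EuclideanSpace ℝ (Fin d) × EuclideanSpace ℝ (Fin k) →
      Measure (EuclideanSpace ℝ (Fin m))}
    (hmarkov : IsMarkovNoise P (fun n => 𝒢 n) Pi (fun n ω => (θ n ω, w n ω)) Z)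
    (hbdd : EventuallyBounded P Z)
    (hgrowth_g : ∃ K₁ : ℝ, ∀ x y z, ‖g (x, y) z‖ ≤ K₁ * (1 + ‖x‖ + ‖y‖ + ‖z‖))
    (hlip : ∃ L, LipschitzWith L (meanField Γ g)) (hpoisson : PoissonRegular Pi Γ g)
    (hmds : ∀ n A, MeasurableSet[𝒢 n] A → ∫ ω in A, M (n + 1) ω ∂P = 0)
    (hM_bound : ∃ K₂ : ℝ, ∀ n, ∀ᵐ ω ∂P, ‖M (n + 1) ω‖ ≤ K₂ * (1 + ‖θ n ω‖ + ‖w n ω‖))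
    {lam : EuclideanSpace ℝ (Fin d) → EuclideanSpace ℝ (Fin k)} (hlam : Continuous lam)
    (hattr : ∀ x, IsGlobalAttractor (fun y => meanField Γ g (x, y)) (lam x)) {R₁ : ℝ}
    (hR₁ : 0 < R₁)
    (hstable : LyapunovStable (fun p : EuclideanSpace ℝ (Fin d) × EuclideanSpace ℝ (Fin k) =>
      ((0 : EuclideanSpace ℝ (Fin d)), meanField Γ g p))
        ((fun x => (x, lam x)) '' Metric.closedBall 0 R₁))
    {B : Set (EuclideanSpace ℝ (Fin k))} (hBc : IsCompact (closure B)) :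
    ∃ K : ℝ, 0 ≤ K ∧ ∃ N : ℕ → Set Ω, ∀ᶠ n₀ in atTop,
      (∀ A, MeasurableSet[𝒢 n₀] A → P (A ∩ N n₀) ≤ ENNReal.ofReal (K * tailSq b n₀ ^ 2) * P A) ∧
      ∀ᵐ ω ∂P, w n₀ ω ∈ B → (∀ n, n₀ ≤ n → ‖θ n ω‖ ≤ R₁) → ω ∉ N n₀ →
        Tendsto (fun n => Metric.infDist (θ n ω, w n ω)
          ((fun x => (x, lam x)) '' Metric.closedBall 0 R₁)) atTop (𝓝 0) := by
  obtain ⟨K₁, hK₁⟩ := hgrowth_h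
  obtain ⟨K₂, hK₂⟩ := hM₁_bound
  obtain ⟨K₃, hK₃⟩ := hgrowth_g
  obtain ⟨K₄, hK₄⟩ := hM_bound
  obtain ⟨L, hL⟩ := hlip
  obtain ⟨c₃, hc₃, hZb⟩ := id hbdd
  have hball : IsCompact (Metric.closedBall (0 : EuclideanSpace ℝ (Fin d)) R₁) :=
    isCompact_closedBall _ _
  have hball0 : (Metric.closedBall (0 : EuclideanSpace ℝ (Fin d)) R₁).Nonempty :=
    ⟨0, Metric.mem_closedBall_self hR₁.le⟩
  obtain ⟨ρ₁, hρ₁⟩ := hBc.isBounded.exists_norm_le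
  obtain ⟨ρ₂, hρ₂⟩ := (hball.image hlam).isBounded.exists_norm_le
  set A : Set (EuclideanSpace ℝ (Fin d) × EuclideanSpace ℝ (Fin k)) :=
    (fun x => (x, lam x)) '' Metric.closedBall 0 R₁ with hA
  -- The second radius is large enough to contain `B` and every fast coordinate within distance `1`
  -- of the graph over the ball.
  set U : Set (EuclideanSpace ℝ (Fin d) × EuclideanSpace ℝ (Fin k)) :=
    Metric.closedBall 0 R₁ ×ˢ Metric.closedBall 0 (max ρ₁ (ρ₂ + 1)) with hU
  set F : EuclideanSpace ℝ (Fin d) × EuclideanSpace ℝ (Fin k) →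
    EuclideanSpace ℝ (Fin d) × EuclideanSpace ℝ (Fin k) := fun p => (0, meanField Γ g p) with hF
  have hFL : LipschitzWith (max 0 L) F := (LipschitzWith.const 0).prodMk hL
  obtain ⟨R, T, δ, hR, hT, hδ, hlock⟩ := exists_forall_norm_le_and_tendsto_infDist hFL
    (U := U) (hball.prod (isCompact_closedBall _ _))
    (prod_subset_domainOfAttraction hL hattr _ _) hstable one_pos
    -- Closeness to the graph does not force the slow coordinate into the closed ball, so this is
    -- imposed separately through `D`.
    (D := {p | p.1 ∈ Metric.closedBall 0 R₁}) fun p hp hpA => by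
      obtain ⟨_, ⟨c, hc, rfl⟩, hpc⟩ := (Metric.infDist_lt_iff (hball0.image _)).1 hpA
      refine ⟨hp, mem_closedBall_zero_iff.2 ((?_ : ‖p.2‖ ≤ ρ₂ + 1).trans (le_max_right _ _))⟩
      have h1 := norm_le_norm_sub_add p.2 (lam c)
      have h2 := hρ₂ _ (Set.mem_image_of_mem lam hc)
      rw [Prod.dist_eq] at hpc
      have h3 := (le_max_right _ _).trans_lt hpc
      rw [dist_eq_norm] at h3
      linarith
  set C₁ : ℝ := |K₁| * (1 + R₁) + |K₂| * (1 + R₁) with hC₁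
  -- The radius is left free: `R` is used for the increments of the pair, `R₁` for the drift of the
  -- slow variable.
  have hslow : ∀ (r : ℝ) n, ∀ᵐ ω ∂P, ‖θ n ω‖ ≤ r →
      ‖θ (n + 1) ω - θ n ω‖ ≤ (|K₁| * (1 + r) + |K₂| * (1 + r)) * a n := by
    intro r n
    filter_upwards [hK₂ n] with ω hω hωR
    have h1 : ‖h (θ n ω) (Z₁ n ω)‖ ≤ |K₁| * (1 + r) :=
      (hK₁ _ _).trans (by gcongr; exact le_abs_self _)
    have h2 : ‖M₁ (n + 1) ω‖ ≤ |K₂| * (1 + r) :=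
      hω.trans (by gcongr; exact le_abs_self _)
    rw [hrecθ, add_sub_cancel_left, norm_smul, Real.norm_of_nonneg (ha.nonneg n), mul_comm]
    exact mul_le_mul_of_nonneg_right ((norm_add_le _ _).trans (add_le_add h1 h2)) (ha.nonneg n)
  set c₁ : ℝ := |K₁| * (1 + R) + |K₂| * (1 + R) with hc₁
  set c₂ : ℝ := |K₃| * (1 + R + R + c₃) + |K₄| * (1 + R + R) with hc₂
  have hc₁0 : 0 ≤ c₁ := by positivity
  have hc₂0 : 0 ≤ c₂ := by positivity
  have hinc : ∀ᶠ n in atTop, ∀ᵐ ω ∂P, ‖(θ n ω, w n ω)‖ ≤ R →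
      ‖(θ (n + 1) ω, w (n + 1) ω) - (θ n ω, w n ω)‖ ≤ (c₁ + c₂) * b n ∧
        ‖M (n + 1) ω‖ ≤ c₁ + c₂ := by
    filter_upwards [hZb] with n hn
    filter_upwards [hslow R n, hK₄ n, hn] with ω h1 h2 h3 hωR
    have hθR : ‖θ n ω‖ ≤ R := (norm_fst_le (θ n ω, w n ω)).trans hωR
    have hwR : ‖w n ω‖ ≤ R := (norm_snd_le (θ n ω, w n ω)).trans hωR
    have h4 : ‖g (θ n ω, w n ω) (Z n ω)‖ ≤ |K₃| * (1 + R + R + c₃) :=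
      (hK₃ _ _ _).trans (by gcongr; exact le_abs_self _)
    have h5 : ‖M (n + 1) ω‖ ≤ |K₄| * (1 + R + R) :=
      h2.trans (by gcongr; exact le_abs_self _)
    have h6 : 0 ≤ |K₃| * (1 + R + R + c₃) := by positivity
    have hb0 := hb.nonneg n
    refine ⟨?_, by linarith⟩
    rw [Prod.mk_sub_mk, Prod.norm_def]
    refine max_le ?_ ?_
    · calc _ ≤ c₁ * a n := h1 hθR
        _ ≤ c₁ * b n := by gcongr; exact (hab n).le
        _ ≤ _ := by gcongr; linarith
    · simp only
      rw [hrecw, add_sub_cancel_left, norm_smul, Real.norm_of_nonneg hb0, mul_comm]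
      refine mul_le_mul_of_nonneg_right ?_ hb0
      linarith [norm_add_le (g (θ n ω, w n ω) (Z n ω)) (M (n + 1) ω)]
  obtain ⟨K, hK, hnoise⟩ := exists_measure_inter_not_noiseSmall_le (fun n => (hθ n).prodMk (hw n))
    hZ hM hmarkov hbdd hpoisson hmds hb hR (by positivity) hinc hδ
  refine ⟨K, hK, fun n₀ => {ω | ¬ NoiseSmall R δ (fun n => (θ n ω, w n ω))
    (noiseSum g (meanField Γ g) b (fun n => (θ n ω, w n ω)) (fun n => Z n ω) (fun n => M n ω)) n₀},
    ?_⟩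
  have hratio : ∀ T' ε : ℝ, 0 < ε → ∀ᶠ n₀ in atTop, ∀ i, n₀ ≤ i →
      C₁ * (a i / b i) * |T'| ≤ ε := fun T' ε hε => by
    have h1 : Tendsto (fun i => C₁ * (a i / b i) * |T'|) atTop (𝓝 0) := by
      simpa using (hab0.const_mul C₁).mul_const |T'|
    exact eventually_forall_ge_atTop.2 (h1.eventually_le_const hε)
  have hsmall : ∀ᶠ n₀ in atTop, ∀ i, n₀ ≤ i → b i ≤ δ :=
    eventually_forall_ge_atTop.2 (hb.tendsto_zero.eventually_le_const hδ)
  filter_upwards [hnoise, hsmall, hratio T δ hδ] with n₀ h1 h2 h3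
  refine ⟨h1, ?_⟩
  filter_upwards [ae_all_iff.2 (hslow R₁)] with ω hωslow hωB hωR hω
  simp only [not_not] at hω
  -- Slow increments are at most `C₁ * (a i / b i) * b i`; over fast time at most `T'` they add up
  -- to at most `ε`, by the smallness of the ratio.
  have hdrift : ∀ {T' ε : ℝ} {n m : ℕ}, 0 < ε → n₀ ≤ n → n ≤ m →
      (∀ i, n ≤ i → C₁ * (a i / b i) * |T'| ≤ ε) → ∑ i ∈ Finset.Ico n m, b i ≤ T' →
      ‖θ m ω - θ n ω‖ ≤ ε := by
    intro T' ε n m hε hn hnm hi hTm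
    rcases eq_or_ne T' 0 with rfl | hT'
    · have h4 : n = m := by
        by_contra hne
        have : 0 < ∑ i ∈ Finset.Ico n m, b i :=
          Finset.sum_pos (fun i _ => hb.1 i) ⟨n, Finset.mem_Ico.2 ⟨le_rfl, by omega⟩⟩
        linarith
      rw [h4, sub_self, norm_zero]
      exact hε.le
    have hT'0 : 0 < |T'| := abs_pos.2 hT'
    rw [sub_eq_sum_Ico (y := fun n => θ n ω) (u := fun i => θ (i + 1) ω - θ i ω)
      (fun i => by abel) hnm]
    calc _ ≤ ∑ i ∈ Finset.Ico n m, ε / |T'| * b i := by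
          refine norm_sum_le_of_le _ fun i hi' => ?_
          rw [Finset.mem_Ico] at hi'
          refine (hωslow i (hωR i (hn.trans hi'.1))).trans ?_
          have h5 := hi i hi'.1
          rw [← le_div_iff₀ hT'0, ← mul_div_assoc, div_le_iff₀ (hb.1 i)] at h5
          exact h5
      _ = ε / |T'| * ∑ i ∈ Finset.Ico n m, b i := by rw [Finset.mul_sum]
      _ ≤ ε / |T'| * |T'| := by gcongr; exact hTm.trans (le_abs_self _)
      _ = ε := by field_simp
  have hdef : ∀ {ε : ℝ} {n m : ℕ}, n ≤ m → ‖θ m ω - θ n ω‖ ≤ ε →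
      ‖noiseSum g (meanField Γ g) b (fun n => (θ n ω, w n ω)) (fun n => Z n ω)
        (fun n => M n ω) n m‖ ≤ ε → ‖eulerDefect F b (fun n => (θ n ω, w n ω)) n m‖ ≤ ε := by
    intro ε n m hnm h4 h5
    rw [← sub_sub_sum_eq_noiseSum (y := fun n => w n ω) _ (fun n => hrecw n ω) hnm] at h5
    have h6 : eulerDefect F b (fun n => (θ n ω, w n ω)) n m = (θ m ω - θ n ω,
        w m ω - w n ω - ∑ i ∈ Finset.Ico n m, b i • meanField Γ g (θ i ω, w i ω)) := by
      refine Prod.ext ?_ ?_ <;> simp [eulerDefect, F, Prod.fst_sum, Prod.snd_sum]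
    rw [h6, Prod.norm_def]
    exact max_le h4 h5
  refine (hlock (fun n => (θ n ω, w n ω)) b n₀ hb h2 ⟨mem_closedBall_zero_iff.2 (hωR n₀ le_rfl),
    mem_closedBall_zero_iff.2 ((hρ₁ _ (subset_closure hωB)).trans (le_max_left _ _))⟩
    (fun n hn => mem_closedBall_zero_iff.2 (hωR n hn)) (fun n m hn hnm hin hTm => ?_)
    (fun hin T' ε hε => ?_)).2
  · exact hdef hnm (hdrift hδ hn hnm (fun i hi => h3 i (hn.trans hi)) hTm) (hω.1 n m hn hnm hin)
  · filter_upwards [hω.2 hin ε hε, hratio T' ε hε, eventually_ge_atTop n₀] with n h4 h5 h6 m hnm hTm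
    exact hdef hnm (hdrift hε h6 hnm h5 hTm) (h4 m hnm)

end TwoTimescales

end Tracking

/-! ### The main theorem -/

theorem mainTheorem4 {d k l m : ℕ}
    {Ω : Type*} [MeasurableSpace Ω] (P : Measure Ω) [IsProbabilityMeasure P]
    -- slow iterate, fast iterate, Markov noises, martingale noises
    (θ : ℕ → Ω → EuclideanSpace ℝ (Fin d)) (w : ℕ → Ω → EuclideanSpace ℝ (Fin k))
    (Z₁ : ℕ → Ω → EuclideanSpace ℝ (Fin l)) (Z₂ : ℕ → Ω → EuclideanSpace ℝ (Fin m))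
    (M₁ : ℕ → Ω → EuclideanSpace ℝ (Fin d)) (M₂ : ℕ → Ω → EuclideanSpace ℝ (Fin k))
    (hθ : ∀ n, Measurable (θ n)) (hw : ∀ n, Measurable (w n))
    (hZ₁ : ∀ n, Measurable (Z₁ n)) (hZ₂ : ∀ n, Measurable (Z₂ n))
    (hM₁ : ∀ n, Measurable (M₁ n)) (hM₂ : ∀ n, Measurable (M₂ n))
    -- vector fields and step sizes
    (h : EuclideanSpace ℝ (Fin d) → EuclideanSpace ℝ (Fin l) → EuclideanSpace ℝ (Fin d))
    (g : EuclideanSpace ℝ (Fin d) × EuclideanSpace ℝ (Fin k) → EuclideanSpace ℝ (Fin m) →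
      EuclideanSpace ℝ (Fin k))
    (hh : Measurable (Function.uncurry h)) (hg : Measurable (Function.uncurry g))
    (a b : ℕ → ℝ)
    -- the recursions
    (hrecθ : ∀ n ω, θ (n + 1) ω = θ n ω + a n • (h (θ n ω) (Z₁ n ω) + M₁ (n + 1) ω))
    (hrecw : ∀ n ω, w (n + 1) ω = w n ω + b n • (g (θ n ω, w n ω) (Z₂ n ω) + M₂ (n + 1) ω))
    -- the filtration
    (ℱ : ℕ → MeasurableSpace Ω)
    (hℱ : ∀ n, ℱ n = Tracking.hist θ n ⊔ Tracking.hist w n ⊔ Tracking.hist M₁ n ⊔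
      Tracking.hist M₂ n ⊔ Tracking.hist Z₁ n ⊔ Tracking.hist Z₂ n)
    -- Markov noise of the slow iterate
    (Pi₁ : Kernel (EuclideanSpace ℝ (Fin d) × EuclideanSpace ℝ (Fin l))
      (EuclideanSpace ℝ (Fin l))) [IsMarkovKernel Pi₁]
    (Γ₁ : EuclideanSpace ℝ (Fin d) → Measure (EuclideanSpace ℝ (Fin l)))
    (hmarkov₁ : Tracking.IsMarkovNoise P ℱ Pi₁ θ Z₁)
    (hbdd₁ : Tracking.EventuallyBounded P Z₁)
    (hinv₁ : Tracking.IsUniqueInvariant Pi₁ Γ₁)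
    (hgrowth_h : ∃ K : ℝ, ∀ x z, ‖h x z‖ ≤ K * (1 + ‖x‖))
    (hlip_h : ∃ L, LipschitzWith L (Tracking.meanField Γ₁ h))
    (hpoisson₁ : Tracking.PoissonRegular Pi₁ Γ₁ h)
    -- Markov noise of the fast iterate
    (Pi₂ : Kernel ((EuclideanSpace ℝ (Fin d) × EuclideanSpace ℝ (Fin k)) ×
      EuclideanSpace ℝ (Fin m)) (EuclideanSpace ℝ (Fin m))) [IsMarkovKernel Pi₂]
    (Γ₂ : EuclideanSpace ℝ (Fin d) × EuclideanSpace ℝ (Fin k) →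
      Measure (EuclideanSpace ℝ (Fin m)))
    (hmarkov₂ : Tracking.IsMarkovNoise P
      (fun n => Tracking.hist Z₂ n ⊔ Tracking.hist θ n ⊔ Tracking.hist w n)
      Pi₂ (fun n ω => (θ n ω, w n ω)) Z₂)
    (hbdd₂ : Tracking.EventuallyBounded P Z₂)
    (hinv₂ : Tracking.IsUniqueInvariant Pi₂ Γ₂)
    (hgrowth_g : ∃ K₁ : ℝ, ∀ x y z, ‖g (x, y) z‖ ≤ K₁ * (1 + ‖x‖ + ‖y‖ + ‖z‖))
    (hint_g : ∀ p, Integrable (g p) (Γ₂ p))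
    (hlip_g : ∃ L, LipschitzWith L (Tracking.meanField Γ₂ g))
    (hpoisson₂ : Tracking.PoissonRegular Pi₂ Γ₂ g)
    -- step sizes
    (ha : Tracking.IsStepSize a) (hb : Tracking.IsStepSize b) (hab : ∀ n, a n < b n)
    (hab0 : Tendsto (fun n => a n / b n) atTop (𝓝 0))
    -- martingale difference noises
    (hmds₁ : Tracking.IsMartingaleDifference P ℱ M₁)
    (hmds₂ : Tracking.IsMartingaleDifference P ℱ M₂)
    (hM₁_bound : ∃ K' : ℝ, ∀ n, ∀ᵐ ω ∂P, ‖M₁ (n + 1) ω‖ ≤ K' * (1 + ‖θ n ω‖))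
    (hM₂_bound : ∃ K₂ : ℝ, ∀ n, ∀ᵐ ω ∂P, ‖M₂ (n + 1) ω‖ ≤ K₂ * (1 + ‖θ n ω‖ + ‖w n ω‖))
    -- the limiting differential equations
    (lam : EuclideanSpace ℝ (Fin d) → EuclideanSpace ℝ (Fin k))
    (hlam : ∃ L, LipschitzWith L lam)
    (hattr : ∀ x, Tracking.IsGlobalAttractor (fun y => Tracking.meanField Γ₂ g (x, y)) (lam x))
    (Hs : Set (EuclideanSpace ℝ (Fin d)))
    (hHs : Tracking.AsymptoticallyStable (Tracking.meanField Γ₁ h) Hs)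
    (hstable : ∀ C : Set (EuclideanSpace ℝ (Fin d)), IsCompact C →
      Tracking.LyapunovStable
        (fun p : EuclideanSpace ℝ (Fin d) × EuclideanSpace ℝ (Fin k) =>
          ((0 : EuclideanSpace ℝ (Fin d)), Tracking.meanField Γ₂ g p))
        ((fun x => (x, lam x)) '' C))
    -- asymptotic tightness of the iterates
    (htight : Tracking.AsymptoticallyTight P (fun n ω => (θ n ω, w n ω)))
    -- the conditioning sets
    (B₁ : Set (EuclideanSpace ℝ (Fin d))) (hB₁ : IsOpen B₁) (hB₁c : IsCompact (closure B₁))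
    (hHB₁ : Hs ⊆ B₁)
    (hB₁G : closure B₁ ⊆ Tracking.domainOfAttraction (Tracking.meanField Γ₁ h) Hs)
    (B₂ : Set (EuclideanSpace ℝ (Fin k))) (hB₂ : IsOpen B₂) (hB₂c : IsCompact (closure B₂)) :
    ∃ e₁ e₂ : ℕ → ℝ, (∀ n, 0 ≤ e₁ n) ∧ (∀ n, 0 ≤ e₂ n) ∧
      e₁ =o[atTop] Tracking.tailSq a ∧ e₂ =o[atTop] Tracking.tailSq b ∧
      ∀ᶠ n₀ in atTop, 0 < 1 - e₁ n₀ - e₂ n₀ ∧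
        (P {ω | θ n₀ ω ∈ B₁ ∧ w n₀ ω ∈ B₂} ≠ 0 →
          (1 - e₁ n₀) * (1 - e₂ n₀ / (1 - e₁ n₀ - e₂ n₀)) ≤
            (P[|{ω | θ n₀ ω ∈ B₁ ∧ w n₀ ω ∈ B₂}]).real
              {ω | Tendsto (fun n => Metric.infDist (θ n ω, w n ω)
                ((fun x => (x, lam x)) '' Hs)) atTop (𝓝 0)}) := by
  have hℱθ : ∀ n, Tracking.hist θ n ≤ ℱ n := fun n => by
    rw [hℱ]; exact le_sup_of_le_left (le_sup_of_le_left (le_sup_of_le_left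
      (le_sup_of_le_left le_sup_left)))
  have hℱw : ∀ n, Tracking.hist w n ≤ ℱ n := fun n => by
    rw [hℱ]; exact le_sup_of_le_left (le_sup_of_le_left (le_sup_of_le_left
      (le_sup_of_le_left le_sup_right)))
  have hℱM₁ : ∀ n, Tracking.hist M₁ n ≤ ℱ n := fun n => by
    rw [hℱ]; exact le_sup_of_le_left (le_sup_of_le_left (le_sup_of_le_left le_sup_right))
  have hℱZ₁ : ∀ n, Tracking.hist Z₁ n ≤ ℱ n := fun n => by
    rw [hℱ]; exact le_sup_of_le_left le_sup_right
  have hℱZ₂ : ∀ n, Tracking.hist Z₂ n ≤ ℱ n := fun n => by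
    rw [hℱ]; exact le_sup_right
  have hℱle : ∀ n, ℱ n ≤ (inferInstance : MeasurableSpace Ω) := fun n => by
    rw [hℱ]
    exact sup_le (sup_le (sup_le (sup_le (sup_le (Tracking.hist_le hθ n) (Tracking.hist_le hw n))
      (Tracking.hist_le hM₁ n)) (Tracking.hist_le hM₂ n)) (Tracking.hist_le hZ₁ n))
      (Tracking.hist_le hZ₂ n)
  have hℱmono : Monotone ℱ := fun i j hij => by
    rw [hℱ, hℱ]
    exact sup_le_sup (sup_le_sup (sup_le_sup (sup_le_sup (sup_le_sup (Tracking.hist_mono θ hij)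
      (Tracking.hist_mono w hij)) (Tracking.hist_mono M₁ hij)) (Tracking.hist_mono M₂ hij))
      (Tracking.hist_mono Z₁ hij)) (Tracking.hist_mono Z₂ hij)
  have hle₂ : ∀ n, Tracking.hist Z₂ n ⊔ Tracking.hist θ n ⊔ Tracking.hist w n ≤ ℱ n := fun n =>
    sup_le (sup_le (hℱZ₂ n) (hℱθ n)) (hℱw n)
  let 𝒢₁ : Filtration ℕ (inferInstance : MeasurableSpace Ω) := ⟨ℱ, hℱmono, hℱle⟩
  -- The Markov property of `Z₂` is given only for this smaller filtration, so the fast estimate has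
  -- to be run in it.
  let 𝒢₂ : Filtration ℕ (inferInstance : MeasurableSpace Ω) :=
    ⟨fun n => Tracking.hist Z₂ n ⊔ Tracking.hist θ n ⊔ Tracking.hist w n,
      fun i j hij => sup_le_sup (sup_le_sup (Tracking.hist_mono Z₂ hij)
        (Tracking.hist_mono θ hij)) (Tracking.hist_mono w hij),
      fun n => (hle₂ n).trans (hℱle n)⟩
  have hθ₂ : ∀ n, Measurable[𝒢₂ n] (θ n) := fun n =>
    (Tracking.measurable_hist θ n).mono (le_sup_of_le_left le_sup_right) le_rfl
  have hw₂ : ∀ n, Measurable[𝒢₂ n] (w n) := fun n =>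
    (Tracking.measurable_hist w n).mono le_sup_right le_rfl
  have hZ₂₂ : ∀ n, Measurable[𝒢₂ n] (Z₂ n) := fun n =>
    (Tracking.measurable_hist Z₂ n).mono (le_sup_of_le_left le_sup_left) le_rfl
  have hM₂₂ : ∀ n, Measurable[𝒢₂ (n + 1)] (M₂ (n + 1)) := fun n => by
    have hmono := 𝒢₂.mono (Nat.le_succ n)
    -- `M₂` does not generate the smaller filtration, but the recursion expresses it through `w`,
    -- `θ` and `Z₂`, so it is adapted.
    have h1 : M₂ (n + 1) = fun ω =>
        (b n)⁻¹ • (w (n + 1) ω - w n ω) - g (θ n ω, w n ω) (Z₂ n ω) := by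
      ext1 ω
      rw [hrecw, add_sub_cancel_left, inv_smul_smul₀ (hb.1 n).ne', add_sub_cancel_left]
    rw [h1]
    exact (((hw₂ (n + 1)).sub ((hw₂ n).mono hmono le_rfl)).const_smul (b n)⁻¹).sub
      (hg.comp ((((hθ₂ n).prodMk (hw₂ n)).prodMk (hZ₂₂ n)).mono hmono le_rfl))
  obtain ⟨R, K₁, hR, hK₁, N₁, hslow⟩ := Tracking.exists_lockIn (𝒢 := 𝒢₁) (P := P)
    (fun n => (Tracking.measurable_hist θ n).mono (hℱθ n) le_rfl)
    (fun n => (Tracking.measurable_hist Z₁ n).mono (hℱZ₁ n) le_rfl)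
    (fun n => (Tracking.measurable_hist M₁ (n + 1)).mono (hℱM₁ (n + 1)) le_rfl) ha hrecθ hmarkov₁
    hbdd₁ hgrowth_h hlip_h hpoisson₁ (fun n A hA => hmds₁.setIntegral_eq_zero (hℱle n) hA)
    hM₁_bound hHs hB₁ hB₁c hHB₁ hB₁G
  obtain ⟨L, hL⟩ := hlam
  obtain ⟨K₂, hK₂, N₂, hfast⟩ := Tracking.exists_tracking (𝒢 := 𝒢₂) (P := P) hθ₂ hw₂ hZ₂₂ hM₂₂
    ha hb hab hab0 hrecθ hrecw hgrowth_h hM₁_bound hmarkov₂ hbdd₂ hgrowth_g hlip_g hpoisson₂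
    (fun n A hA => hmds₂.setIntegral_eq_zero (hℱle n) (hle₂ n A hA)) hM₂_bound hL.continuous hattr
    hR (hstable _ (isCompact_closedBall 0 R)) hB₂c
  refine ⟨fun n => K₁ * Tracking.tailSq a n ^ 2, fun n => K₂ * Tracking.tailSq b n ^ 2,
    fun n => by positivity, fun n => by positivity, Tracking.isLittleO_const_mul_tailSq_sq K₁ a,
    Tracking.isLittleO_const_mul_tailSq_sq K₂ b, ?_⟩
  have hlim : Tendsto (fun n => 1 - K₁ * Tracking.tailSq a n ^ 2 - K₂ * Tracking.tailSq b n ^ 2)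
      atTop (𝓝 1) := by
    simpa using (((Tracking.tendsto_tailSq a).pow 2).const_mul K₁).const_sub 1 |>.sub
      (((Tracking.tendsto_tailSq b).pow 2).const_mul K₂)
  filter_upwards [hslow, hfast, hlim.eventually_const_lt one_pos] with n₀ h1 h2 h3
  refine ⟨h3, fun hP => ?_⟩
  set e₁ := K₁ * Tracking.tailSq a n₀ ^ 2 with he₁
  set e₂ := K₂ * Tracking.tailSq b n₀ ^ 2 with he₂
  have he₁0 : 0 ≤ e₁ := by positivity
  have he₂0 : 0 ≤ e₂ := by positivity
  -- Membership in the smaller filtration lets both conditional estimates be applied to this event.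
  have hBm : MeasurableSet[𝒢₂ n₀] {ω | θ n₀ ω ∈ B₁ ∧ w n₀ ω ∈ B₂} :=
    (hθ₂ n₀ hB₁.measurableSet).inter (hw₂ n₀ hB₂.measurableSet)
  refine le_trans ?_ (Tracking.le_measureReal_cond (𝒢₂.le _ _ hBm) hP he₁0 he₂0
    (h1.1 _ (hle₂ n₀ _ hBm)) (h2.1 _ hBm) ?_)
  -- The claimed bound is `1 - e₁ - (1 - e₁) * e₂ / (1 - e₁ - e₂)`, which is at most `1 - e₁ - e₂`
  -- because `1 - e₁ ≥ 1 - e₁ - e₂ > 0`.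
  · have h4 : e₂ ≤ (1 - e₁) * (e₂ / (1 - e₁ - e₂)) := by
      rw [← mul_div_assoc, le_div_iff₀ h3, mul_comm]
      exact mul_le_mul_of_nonneg_right (by linarith) he₂0
    linarith
  · filter_upwards [h2.2] with ω h4 hω hN₁ hN₂
    obtain ⟨h5, h6⟩ := h1.2 ω hω.1 hN₁
    have h7 := (((h4 hω.2 h5 hN₂).add h6).const_mul (1 + (L : ℝ)))
    rw [add_zero, mul_zero] at h7
    exact squeeze_zero (fun n => Metric.infDist_nonneg) (fun n => Tracking.infDist_graph_le hL
      (isCompact_closedBall 0 R) ⟨0, Metric.mem_closedBall_self hR.le⟩ hHs.1 hHs.2.1 _) h7
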